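/- An $\omega$-model is a model of $\mathsf{RCA}_0$ whose first-order part is the standard natural numbers; identify it with the collection $\mathcal I \subseteq \mathcal P(\omega)$ of its sets. Write $X^{(k)}$ for the $k$-th Turing jump of $X$, and $Y \gg X$ if $Y$ computes a path through every $X$-computable infinite binary tree $T \subseteq 2^{<\omega}$. Let $\mathsf{WKL}^{(m)}$ be the statement "for every $X$ there is a $Y$ with $Y^{(m)} \gg X^{(m)}$", and let $\mathsf{AST}^{(n)}$ be the statement "for every $X$ there is a $Y$ with $Y^{(n)} \nleq_{\mathrm T} X^{(n)}$". Theorem. For all natural numbers $m < n$ we have $\mathsf{AST}^{(n)} \nleqslant_\omega \mathsf{WKL}^{(m)}$; that is, there is an $\omega$-model that satisfies $\mathsf{WKL}^{(m)}$ and does not satisfy $\mathsf{AST}^{(n)}$. -/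

import Mathlib

namespace IterJump

/-! ### Turing reducibility and the Turing jump for sets of natural numbers -/

/-- The characteristic function of `X`, as a (total) partial function. -/
noncomputable def chi (X : Set ℕ) : ℕ →. ℕ :=
  open Classical in fun n => Part.some (if n ∈ X then 1 else 0)

/-- Turing reducibility `A ≤_T B` between sets of natural numbers. -/
def TRed (A B : Set ℕ) : Prop := TuringReducible (chi A) (chi B)

/-- Programs with an oracle, one constructor for each clause of `Nat.RecursiveIn`. -/
inductive OCode : Type
  | zero : OCode
  | succ : OCode
  | left : OCode
  | right : OCode
  | oracle : OCode
  | pair : OCode → OCode → OCode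
  | comp : OCode → OCode → OCode
  | prec : OCode → OCode → OCode
  | rfind : OCode → OCode

namespace OCode

/-- The Gödel number of an oracle program. -/
def encode : OCode → ℕ
  | zero => 0
  | succ => 1
  | left => 2
  | right => 3
  | oracle => 4
  | pair f h => 4 * Nat.pair (encode f) (encode h) + 5
  | comp f h => 4 * Nat.pair (encode f) (encode h) + 6
  | prec f h => 4 * Nat.pair (encode f) (encode h) + 7
  | rfind f => 4 * encode f + 8

theorem encode_injective : Function.Injective encode := by
  intro c
  induction c <;> intro d h <;> cases d <;> simp only [encode] at h <;>
    first
    | rfl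
    | (exfalso; omega)
    | (rename_i f g ihf ihg f' g'
       have h' := Nat.pair_eq_pair.1 (show Nat.pair (encode f) (encode g)
         = Nat.pair (encode f') (encode g') by omega)
       rw [ihf h'.1, ihg h'.2])
    | (rename_i f ihf f'
       rw [ihf (show encode f = encode f' by omega)])

/-- The partial function computed by a program with oracle `X`. -/
noncomputable def eval (X : Set ℕ) : OCode → ℕ →. ℕ
  | zero => fun _ => Part.some 0
  | succ => fun n => Part.some (n + 1)
  | left => fun n => Part.some (Nat.unpair n).1
  | right => fun n => Part.some (Nat.unpair n).2
  | oracle => chi X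
  | pair f h => fun n => Nat.pair <$> eval X f n <*> eval X h n
  | comp f h => fun n => eval X h n >>= eval X f
  | prec f h => fun p =>
      let (a, n) := Nat.unpair p
      n.rec (eval X f a) fun y IH => do
        let i ← IH
        eval X h (Nat.pair a (Nat.pair y i))
  | rfind f => fun a =>
      Nat.rfind fun n => (fun m => decide (m = 0)) <$> eval X f (Nat.pair a n)

/-- Oracle programs compute exactly the functions that Mathlib calls recursive in the oracle. -/
theorem recursiveIn_iff_exists_eval (X : Set ℕ) (f : ℕ →. ℕ) :
    Nat.RecursiveIn {chi X} f ↔ ∃ c, eval X c = f := by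
  constructor
  · intro hf
    induction hf with
    | zero => exact ⟨zero, rfl⟩
    | succ => exact ⟨succ, rfl⟩
    | left => exact ⟨left, rfl⟩
    | right => exact ⟨right, rfl⟩
    | oracle g hg => rw [Set.mem_singleton_iff] at hg; exact ⟨oracle, hg.symm⟩
    | pair _ _ ihf ihh =>
      obtain ⟨c, rfl⟩ := ihf; obtain ⟨d, rfl⟩ := ihh; exact ⟨pair c d, rfl⟩
    | comp _ _ ihf ihh =>
      obtain ⟨c, rfl⟩ := ihf; obtain ⟨d, rfl⟩ := ihh; exact ⟨comp c d, rfl⟩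
    | prec _ _ ihf ihh =>
      obtain ⟨c, rfl⟩ := ihf; obtain ⟨d, rfl⟩ := ihh; exact ⟨prec c d, rfl⟩
    | rfind _ ihf => obtain ⟨c, rfl⟩ := ihf; exact ⟨rfind c, rfl⟩
  · rintro ⟨c, rfl⟩
    induction c with
    | zero => exact .zero
    | succ => exact .succ
    | left => exact .left
    | right => exact .right
    | oracle => exact .oracle _ rfl
    | pair _ _ ihf ihh => exact .pair ihf ihh
    | comp _ _ ihf ihh => exact .comp ihf ihh
    | prec _ _ ihf ihh => exact .prec ihf ihh
    | rfind _ ihf => exact .rfind ihf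

end OCode

/-- The Turing jump `X' = {e | Φ_e^X(e)↓}`, where `Φ_e` is the oracle program with number `e`. -/
def jump (X : Set ℕ) : Set ℕ :=
  {e | ∃ c : OCode, c.encode = e ∧ (c.eval X e).Dom}

/-- The iterated jump `X^(m)`. -/
def iterJump (m : ℕ) (X : Set ℕ) : Set ℕ := jump^[m] X

/-! ### PA degrees -/

/-- `T ⊆ 2^{<ℕ}` is an infinite binary tree: infinite and closed under initial segments. -/
def IsInfiniteTree (T : Set (List Bool)) : Prop :=
  T.Infinite ∧ ∀ σ ∈ T, ∀ τ : List Bool, τ <+: σ → τ ∈ T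

/-- `f ∈ 2^ℕ` is a path through `T`: all its initial segments `f(0), …, f(n-1)` lie in `T`. -/
def IsPath (f : ℕ → Bool) (T : Set (List Bool)) : Prop :=
  ∀ n : ℕ, (List.range n).map f ∈ T

/-- `Y ≫ X` (`Y` is of PA degree over `X`): `Y` computes a path through every `X`-computable
infinite binary tree. -/
def PAOver (Y X : Set ℕ) : Prop :=
  open Classical in
  ∀ T : Set (List Bool), IsInfiniteTree T →
    ComputableIn {chi X} (fun σ : List Bool => decide (σ ∈ T)) →
    ∃ f : ℕ → Bool, IsPath f T ∧ ComputableIn {chi Y} f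

/-! ### `ω`-models

Number variables and set variables are de Bruijn indices, interpreted by assignments
`v : ℕ → ℕ` and `V : ℕ → Set ℕ`. -/

/-- Numerical terms of the language of second-order arithmetic. -/
inductive Tm : Type
  | var : ℕ → Tm
  | zero : Tm
  | one : Tm
  | add : Tm → Tm → Tm
  | mul : Tm → Tm → Tm

/-- The value of a term in the standard natural numbers. -/
def Tm.val (v : ℕ → ℕ) : Tm → ℕ
  | var i => v i
  | zero => 0
  | one => 1
  | add s t => s.val v + t.val v
  | mul s t => s.val v * t.val v

/-- Bounded-quantifier (`Δ⁰₀`) formulas of the language of second-order arithmetic; free set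
variables are allowed. The other connectives and the bounded existential quantifier are
definable from these. -/
inductive BFormula : Type
  | eq : Tm → Tm → BFormula
  | lt : Tm → Tm → BFormula
  | mem : Tm → ℕ → BFormula
  | not : BFormula → BFormula
  | and : BFormula → BFormula → BFormula
  | ball : Tm → BFormula → BFormula

/-- The assignment that sends variable `0` to `x` and variable `i + 1` to `v i`. -/
def consVar (x : ℕ) (v : ℕ → ℕ) : ℕ → ℕ
  | 0 => x
  | i + 1 => v i

/-- Satisfaction of a bounded-quantifier formula over the standard natural numbers.
`ball t φ` is `∀ x < t, φ`, where `x` is variable `0` of `φ` and does not occur in `t`. -/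
def BFormula.Sat (V : ℕ → Set ℕ) : BFormula → (ℕ → ℕ) → Prop
  | eq s t, v => s.val v = t.val v
  | lt s t, v => s.val v < t.val v
  | mem t i, v => t.val v ∈ V i
  | not φ, v => ¬ φ.Sat V v
  | and φ ψ, v => φ.Sat V v ∧ ψ.Sat V v
  | ball t φ, v => ∀ x, x < t.val v → φ.Sat V (consVar x v)

/-- Satisfaction of the `Σ⁰₁` formula `∃ x, θ`, with `x` variable `0` of `θ`. -/
def SatSigma1 (θ : BFormula) (V : ℕ → Set ℕ) (v : ℕ → ℕ) : Prop :=
  ∃ x, θ.Sat V (consVar x v)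

/-- Satisfaction of the `Π⁰₁` formula `∀ x, θ`, with `x` variable `0` of `θ`. -/
def SatPi1 (θ : BFormula) (V : ℕ → Set ℕ) (v : ℕ → ℕ) : Prop :=
  ∀ x, θ.Sat V (consVar x v)

/-- `I` is (the second-order part of) an `ω`-model: the structure with standard first-order part
`(ℕ, 0, 1, +, ·, <)`, whose sets are the members of `I`, is a model of `RCA₀`. The basic axioms
for `(ℕ, 0, 1, +, ·, <)` hold in every such structure; the remaining axioms are the two schemes
below, with arbitrary number parameters `v` and set parameters `V`. -/
structure IsOmegaModel (I : Set (Set ℕ)) : Prop where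
  nonempty : I.Nonempty
  sigma1_induction : ∀ (θ : BFormula) (V : ℕ → Set ℕ) (v : ℕ → ℕ), (∀ i, V i ∈ I) →
    SatSigma1 θ V (consVar 0 v) →
    (∀ k, SatSigma1 θ V (consVar k v) → SatSigma1 θ V (consVar (k + 1) v)) →
    ∀ k, SatSigma1 θ V (consVar k v)
  delta1_comprehension : ∀ (θ η : BFormula) (V : ℕ → Set ℕ) (v : ℕ → ℕ), (∀ i, V i ∈ I) →
    (∀ k, SatSigma1 θ V (consVar k v) ↔ SatPi1 η V (consVar k v)) →
    ∃ X ∈ I, ∀ k, k ∈ X ↔ SatSigma1 θ V (consVar k v)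

/-! ### The principles

For subsets `X`, `Y` of `ℕ` the relations `Y^(m) ≫ X^(m)` and `Y^(n) ≤_T X^(n)` are arithmetical
in `X` and `Y`, hence have their true meaning in every `ω`-model. -/

/-- The `ω`-model `I` satisfies `WKL^(m)`: for every `X` there is `Y` with `Y^(m) ≫ X^(m)`. -/
def ModelsWKL (m : ℕ) (I : Set (Set ℕ)) : Prop :=
  ∀ X ∈ I, ∃ Y ∈ I, PAOver (iterJump m Y) (iterJump m X)

/-- The `ω`-model `I` satisfies `AST^(n)`: for every `X` there is `Y` with `Y^(n) ≰_T X^(n)`. -/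
def ModelsAST (n : ℕ) (I : Set (Set ℕ)) : Prop :=
  ∀ X ∈ I, ∃ Y ∈ I, ¬ TRed (iterJump n Y) (iterJump n X)

end IterJump

/-!
The model is the ideal generated by a chain `∅ = Z₀ ≤_T Z₁ ≤_T ⋯` in which
`Z_{k+1}^(m) ≫ Z_k^(m)` and `Z_{k+1}^(m+1) ≤_T Z_k^(m+1)`. The first property gives `WKL^(m)`. By
the second, `Y^(m+1) ≤_T ∅^(m+1)` for all `Y` in the ideal, hence `Y^(n) ≤_T ∅^(n)` for all
`n > m`, and `AST^(n)` fails at `X = ∅`.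

One step of the chain (`exists_iterJump_paOver_low`) combines two classical theorems. The low basis
theorem (`exists_low_path`), applied to the class of `{0,1}`-valued functions that are diagonally
noncomputable relative to `Z^(m)`, gives `P ≫ Z^(m)` with `P' ≤_T Z^(m+1)`
(`exists_low_paOver`). Since `P ≥_T Z^(m)`, Friedberg's jump inversion theorem
(`exists_jump_inversion`), iterated `m` times, gives `Y ≥_T Z` with `Y^(m) ≡_T P`.

All computability is carried out with relations that are r.e. in a set (`REIn`), where closure
under the logical operations replaces the construction of programs. Two results link this to oracle
programs. The enumeration theorem: the graph of `(e, n) ↦ Φ_e^X(n)` is r.e. in `X`, uniformly in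
`X`, because a computation is witnessed by a finite list of facts each of which follows from later
ones by a defining clause of `OCode.eval` (`mem_eval_iff_derivable`). Conversely, every relation
r.e. in `X` is uniformized by a program (`REIn.exists_code`), so it is many-one reducible to `X'`.
Being computable in `X` then means that both the relation and its negation are r.e. in `X`
(`tRed_iff`, `computableIn_bool_iff`). The same calculus shows that every ideal generated by a chain
satisfies `Δ⁰₁` comprehension (`isOmegaModel_of_chain`).
-/

namespace IterJump

open Encodable

/-! ### Primitive recursive predicates with bounded quantifiers -/

section Primrec

variable {α β : Type} [Primcodable α] [Primcodable β]

theorem primrecPred_exists_mem {g : α → List β} {q : α → β → Prop} (hg : Primrec g)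
    (hq : PrimrecPred fun x : α × β => q x.1 x.2) : PrimrecPred fun a => ∃ b ∈ g a, q a b :=
  (PrimrecRel.exists_mem_list (R := fun b a => q a b)
    (hq.comp (Primrec.snd.pair Primrec.fst))).comp hg Primrec.id

theorem primrecPred_forall_mem {g : α → List β} {q : α → β → Prop} (hg : Primrec g)
    (hq : PrimrecPred fun x : α × β => q x.1 x.2) : PrimrecPred fun a => ∀ b ∈ g a, q a b :=
  (PrimrecRel.forall_mem_list (R := fun b a => q a b)
    (hq.comp (Primrec.snd.pair Primrec.fst))).comp hg Primrec.id

theorem primrecPred_exists_lt {g : α → ℕ} {q : α → ℕ → Prop} (hg : Primrec g)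
    (hq : PrimrecPred fun x : α × ℕ => q x.1 x.2) : PrimrecPred fun a => ∃ b < g a, q a b :=
  (primrecPred_exists_mem (Primrec.list_range.comp hg) hq).of_eq (by simp)

theorem primrecPred_forall_lt {g : α → ℕ} {q : α → ℕ → Prop} (hg : Primrec g)
    (hq : PrimrecPred fun x : α × ℕ => q x.1 x.2) : PrimrecPred fun a => ∀ b < g a, q a b :=
  (primrecPred_forall_mem (Primrec.list_range.comp hg) hq).of_eq (by simp)

theorem primrecPred_exists_mem_option {g : α → Option β} {q : α → β → Prop} (hg : Primrec g)
    (hq : PrimrecPred fun x : α × β => q x.1 x.2) : PrimrecPred fun a => ∃ b ∈ g a, q a b :=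
  (primrecPred_exists_mem (Primrec.optionToList.comp hg) hq).of_eq (by simp)

theorem primrecPred_eq {f g : α → β} (hf : Primrec f) (hg : Primrec g) :
    PrimrecPred fun a => f a = g a :=
  Primrec.eq.comp hf hg

theorem primrecPred_prefix : PrimrecPred fun x : List β × List β => x.1 <+: x.2 :=
  (primrecPred_eq (Primrec.list_take.comp (Primrec.list_length.comp Primrec.fst) Primrec.snd)
    Primrec.fst).of_eq fun x => by rw [List.prefix_iff_eq_take, eq_comm]

end Primrec

/-! ### Initial segments of a set -/

/-- The initial segment of length `n` of the characteristic function of `X`. -/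
noncomputable def seg (X : Set ℕ) (n : ℕ) : List Bool :=
  open Classical in (List.range n).map fun i => decide (i ∈ X)

@[simp] theorem length_seg (X : Set ℕ) (n : ℕ) : (seg X n).length = n := by simp [seg]

theorem seg_succ (X : Set ℕ) (n : ℕ) [Decidable (n ∈ X)] :
    seg X (n + 1) = seg X n ++ [decide (n ∈ X)] := by
  simp only [seg, List.range_succ, List.map_append, List.map_cons, List.map_nil]
  congr

theorem take_seg (X : Set ℕ) (m n : ℕ) : (seg X n).take m = seg X (min m n) := by
  simp [seg, ← List.map_take, List.take_range]

theorem seg_prefix_seg (X : Set ℕ) {m n : ℕ} (h : m ≤ n) : seg X m <+: seg X n := by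
  rw [List.prefix_iff_eq_take, length_seg, take_seg, min_eq_left h]

theorem prefix_seg_iff {X : Set ℕ} {n : ℕ} {σ : List Bool} :
    σ <+: seg X n ↔ σ.length ≤ n ∧ σ = seg X σ.length := by
  constructor
  · intro h
    have hl : σ.length ≤ n := by simpa using h.length_le
    refine ⟨hl, ?_⟩
    have := List.prefix_iff_eq_take.1 h
    rwa [take_seg, min_eq_left hl] at this
  · rintro ⟨h, e⟩
    rw [e]
    exact seg_prefix_seg X (by simpa using h)

theorem seg_getElem?_true {X : Set ℕ} {n i : ℕ} : (seg X n)[i]? = some true ↔ i < n ∧ i ∈ X := by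
  simp only [seg, List.getElem?_map, Option.map_eq_some_iff]
  constructor
  · rintro ⟨a, h, h'⟩
    obtain ⟨h1, h2⟩ := List.getElem?_eq_some_iff.1 h
    simp at h1 h2
    subst h2
    exact ⟨h1, by simpa using h'⟩
  · rintro ⟨h, h'⟩
    exact ⟨i, by simp [h], by simpa using h'⟩

theorem seg_getElem?_false {X : Set ℕ} {n i : ℕ} :
    (seg X n)[i]? = some false ↔ i < n ∧ i ∉ X := by
  by_cases hi : i < n
  · have h : ∃ b, (seg X n)[i]? = some b := ⟨_, List.getElem?_eq_getElem (by simpa using hi)⟩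
    obtain ⟨b, hb⟩ := h
    have := seg_getElem?_true (X := X) (n := n) (i := i)
    rw [hb] at this ⊢
    cases b <;> simp_all
  · simp [hi]

theorem eq_seg_iff {X : Set ℕ} {σ : List Bool} : σ = seg X σ.length ↔
    ∀ i < σ.length, (σ[i]? = some true ∧ i ∈ X) ∨ (σ[i]? = some false ∧ i ∉ X) := by
  constructor
  · intro h i hi
    have h1 := seg_getElem?_true (X := X) (n := σ.length) (i := i)
    have h2 := seg_getElem?_false (X := X) (n := σ.length) (i := i)
    rw [← h] at h1 h2
    by_cases hX : i ∈ X
    · exact .inl ⟨h1.2 ⟨hi, hX⟩, hX⟩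
    · exact .inr ⟨h2.2 ⟨hi, hX⟩, hX⟩
  · intro h
    refine List.ext_getElem? fun i => ?_
    by_cases hi : i < σ.length
    · rcases h i hi with ⟨h1, h2⟩ | ⟨h1, h2⟩
      · rw [h1, seg_getElem?_true.2 ⟨hi, h2⟩]
      · rw [h1, seg_getElem?_false.2 ⟨hi, h2⟩]
    · rw [List.getElem?_eq_none (by omega), List.getElem?_eq_none (by simp; omega)]

/-! ### Relations that are recursively enumerable in a set -/

/-- `p` is recursively enumerable in `X`: `p a` holds iff some finite initial segment of `X`
witnesses it, for a primitive recursive notion of witness. -/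
def REIn {α : Type} [Primcodable α] (X : Set ℕ) (p : α → Prop) : Prop :=
  ∃ R : α → List Bool → Prop, (PrimrecPred fun x : α × List Bool => R x.1 x.2) ∧
    ∀ a, p a ↔ ∃ n, R a (seg X n)

namespace REIn

variable {α β : Type} [Primcodable α] [Primcodable β] {X A B : Set ℕ} {p q : α → Prop}

theorem of_iff (hp : REIn X p) (h : ∀ a, q a ↔ p a) : REIn X q := by
  rwa [show q = p from funext fun a => propext (h a)]

/-- The witnesses can be chosen to be closed under end extension. -/
theorem exists_mono (hp : REIn X p) : ∃ R : α → List Bool → Prop,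
    (PrimrecPred fun x : α × List Bool => R x.1 x.2) ∧
    (∀ a σ τ, σ <+: τ → R a σ → R a τ) ∧ ∀ a, p a ↔ ∃ n, R a (seg X n) := by
  obtain ⟨R, hR, h⟩ := hp
  refine ⟨fun a σ => ∃ n < σ.length + 1, R a (σ.take n), ?_, ?_, ?_⟩
  · exact primrecPred_exists_lt (q := fun x n => R x.1 (x.2.take n))
      (Primrec.succ.comp (Primrec.list_length.comp Primrec.snd))
      (hR.comp ((Primrec.fst.comp Primrec.fst).pair
        (Primrec.list_take.comp Primrec.snd (Primrec.snd.comp Primrec.fst))))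
  · rintro a σ τ hστ ⟨n, hn, hr⟩
    have hl := hστ.length_le
    refine ⟨n, by omega, ?_⟩
    obtain ⟨ρ, rfl⟩ := hστ
    rwa [List.take_append_of_le_length (by omega)]
  · intro a
    rw [h]
    constructor
    · rintro ⟨n, hn⟩
      exact ⟨n, n, by simp, by rwa [take_seg, min_self]⟩
    · rintro ⟨n, m, -, hm⟩
      rw [take_seg] at hm
      exact ⟨_, hm⟩

theorem of_primrec (hp : PrimrecPred p) : REIn X p :=
  ⟨fun a _ => p a, hp.comp Primrec.fst, fun a => by simp⟩

theorem comp {p : β → Prop} (hp : REIn X p) {f : α → β} (hf : Primrec f) :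
    REIn X fun a => p (f a) := by
  obtain ⟨R, hR, h⟩ := hp
  exact ⟨fun a σ => R (f a) σ, hR.comp ((hf.comp Primrec.fst).pair Primrec.snd), fun a => h _⟩

theorem and (hp : REIn X p) (hq : REIn X q) : REIn X fun a => p a ∧ q a := by
  obtain ⟨R, hR, mR, h⟩ := hp.exists_mono
  obtain ⟨S, hS, mS, h'⟩ := hq.exists_mono
  refine ⟨fun a σ => R a σ ∧ S a σ, hR.and hS, fun a => ?_⟩
  change p a ∧ q a ↔ _
  rw [h, h']
  constructor
  · rintro ⟨⟨n, hn⟩, m, hm⟩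
    exact ⟨max n m, mR _ _ _ (seg_prefix_seg X (le_max_left _ _)) hn,
      mS _ _ _ (seg_prefix_seg X (le_max_right _ _)) hm⟩
  · rintro ⟨n, hn, hm⟩
    exact ⟨⟨n, hn⟩, n, hm⟩

theorem or (hp : REIn X p) (hq : REIn X q) : REIn X fun a => p a ∨ q a := by
  obtain ⟨R, hR, h⟩ := hp
  obtain ⟨S, hS, h'⟩ := hq
  refine ⟨fun a σ => R a σ ∨ S a σ, hR.or hS, fun a => ?_⟩
  change p a ∨ q a ↔ _
  rw [h, h', exists_or]

theorem ex {q : α → β → Prop} (hq : REIn X fun x : α × β => q x.1 x.2) :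
    REIn X fun a => ∃ b, q a b := by
  obtain ⟨R, hR, mR, h⟩ := hq.exists_mono
  -- the length of the oracle segment also bounds the search for `b`
  refine ⟨fun a σ => ∃ i < σ.length, ∃ b ∈ (decode i : Option β), R (a, b) σ, ?_, fun a => ?_⟩
  · refine primrecPred_exists_lt
      (q := fun (x : α × List Bool) i => ∃ b ∈ (decode i : Option β), R (x.1, b) x.2)
      (Primrec.list_length.comp Primrec.snd) ?_
    refine primrecPred_exists_mem_option
      (q := fun (x : (α × List Bool) × ℕ) b => R (x.1.1, b) x.1.2)
      (Primrec.decode.comp Primrec.snd) ?_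
    exact hR.comp (((Primrec.fst.comp (Primrec.fst.comp Primrec.fst)).pair Primrec.snd).pair
      (Primrec.snd.comp (Primrec.fst.comp Primrec.fst)))
  · constructor
    · rintro ⟨b, hb⟩
      obtain ⟨n, hn⟩ := (h (a, b)).1 hb
      refine ⟨max n (encode b + 1), encode b, by simp, b, by simp,
        mR _ _ _ (seg_prefix_seg X (le_max_left _ _)) hn⟩
    · rintro ⟨n, i, -, b, -, hb⟩
      exact ⟨b, (h (a, b)).2 ⟨n, hb⟩⟩

theorem forall_mem {g : α → List β} {q : α → β → Prop} (hg : Primrec g)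
    (hq : REIn X fun x : α × β => q x.1 x.2) : REIn X fun a => ∀ b ∈ g a, q a b := by
  obtain ⟨R, hR, mR, h⟩ := hq.exists_mono
  refine ⟨fun a σ => ∀ b ∈ g a, R (a, b) σ, ?_, fun a => ?_⟩
  · refine primrecPred_forall_mem (q := fun x b => R (x.1, b) x.2) (hg.comp Primrec.fst) ?_
    exact hR.comp (((Primrec.fst.comp Primrec.fst).pair Primrec.snd).pair
      (Primrec.snd.comp Primrec.fst))
  · constructor
    · intro H
      -- the witnesses for the members of the list are bounded by their maximum
      change ∀ b ∈ g a, q a b at H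
      change ∃ n, ∀ b ∈ g a, R (a, b) (seg X n)
      generalize g a = l at H ⊢
      induction l with
      | nil => exact ⟨0, by simp⟩
      | cons b l ih =>
        obtain ⟨n, hn⟩ := ih fun b hb => H b (by simp [hb])
        obtain ⟨m, hm⟩ := (h (a, b)).1 (H b (by simp))
        refine ⟨max n m, fun c hc => ?_⟩
        rcases List.mem_cons.1 hc with rfl | hc
        · exact mR _ _ _ (seg_prefix_seg X (le_max_right _ _)) hm
        · exact mR _ _ _ (seg_prefix_seg X (le_max_left _ _)) (hn c hc)
    · rintro ⟨n, hn⟩ b hb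
      exact (h (a, b)).2 ⟨n, hn b hb⟩

theorem forall_lt {g : α → ℕ} {q : α → ℕ → Prop} (hg : Primrec g)
    (hq : REIn X fun x : α × ℕ => q x.1 x.2) : REIn X fun a => ∀ i < g a, q a i :=
  (forall_mem (Primrec.list_range.comp hg) hq).of_iff (by simp)

theorem mem_self (X : Set ℕ) : REIn X (· ∈ X) := by
  refine ⟨fun n σ => σ[n]? = some true,
    primrecPred_eq (Primrec.list_getElem?.comp Primrec.snd Primrec.fst) (Primrec.const _),
    fun n => ?_⟩
  simp only [seg_getElem?_true]
  exact ⟨fun h => ⟨n + 1, by omega, h⟩, fun ⟨_, _, h⟩ => h⟩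

theorem notMem_self (X : Set ℕ) : REIn X (· ∉ X) := by
  refine ⟨fun n σ => σ[n]? = some false,
    primrecPred_eq (Primrec.list_getElem?.comp Primrec.snd Primrec.fst) (Primrec.const _),
    fun n => ?_⟩
  simp only [seg_getElem?_false]
  exact ⟨fun h => ⟨n + 1, by omega, h⟩, fun ⟨_, _, h⟩ => h⟩

/-- Being an initial segment of `A` is r.e. in `B` if `A` and its complement are. -/
theorem eq_seg (h : REIn B (· ∈ A)) (h' : REIn B (· ∉ A)) :
    REIn B fun σ : List Bool => σ = seg A σ.length := by
  refine of_iff (forall_lt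
    (q := fun σ i => (σ[i]? = some true ∧ i ∈ A) ∨ (σ[i]? = some false ∧ i ∉ A))
    Primrec.list_length ?_) fun σ => eq_seg_iff
  refine or (and (of_primrec ?_) (h.comp Primrec.snd)) (and (of_primrec ?_) (h'.comp Primrec.snd))
  all_goals
    exact primrecPred_eq (α := List Bool × ℕ) (Primrec.list_getElem?.comp Primrec.fst Primrec.snd)
      (Primrec.const _)

/-- Replacing an oracle by one in which it is decidable. -/
theorem subst (h : REIn B (· ∈ A)) (h' : REIn B (· ∉ A)) (hp : REIn A p) : REIn B p := by
  obtain ⟨R, hR, hp⟩ := hp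
  refine of_iff (ex (q := fun a (σ : List Bool) => σ = seg A σ.length ∧ R a σ)
    (((eq_seg h h').comp Primrec.snd).and (of_primrec hR))) fun a => ?_
  rw [hp]
  constructor
  · rintro ⟨n, hn⟩
    exact ⟨seg A n, by simp, hn⟩
  · rintro ⟨σ, hσ, hr⟩
    exact ⟨σ.length, hσ ▸ hr⟩

/-- The graph of a sequence defined by recursion is r.e. in `X` if the relation between
consecutive terms is: the finite list of the terms up to a given one is a witness. -/
theorem seq {s : ℕ → β} {step : ℕ → β → β → Prop}
    (h : REIn X fun x : (ℕ × β) × β => step x.1.1 x.1.2 x.2)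
    (hs : ∀ i b, step i (s i) b ↔ b = s (i + 1)) :
    REIn X fun x : ℕ × β => x.2 = s x.1 := by
  refine of_iff (ex (q := fun x (l : List β) => l[0]? = some (s 0) ∧ l[x.1]? = some x.2 ∧
    ∀ i < x.1, ∃ b b', (l[i]? = some b ∧ l[i + 1]? = some b') ∧ step i b b') ?_) ?_
  · refine and (of_primrec ?_) (and (of_primrec ?_) ?_)
    · exact primrecPred_eq (Primrec.list_getElem?.comp Primrec.snd (Primrec.const _))
        (Primrec.const _)
    · exact primrecPred_eq (Primrec.list_getElem?.comp Primrec.snd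
        (Primrec.fst.comp Primrec.fst)) (Primrec.option_some.comp (Primrec.snd.comp Primrec.fst))
    · refine forall_lt (q := fun (x : (ℕ × β) × List β) i => ∃ b b',
        (x.2[i]? = some b ∧ x.2[i + 1]? = some b') ∧ step i b b') (Primrec.fst.comp Primrec.fst) ?_
      refine ex (q := fun (x : ((ℕ × β) × List β) × ℕ) b => ∃ b',
        (x.1.2[x.2]? = some b ∧ x.1.2[x.2 + 1]? = some b') ∧ step x.2 b b') ?_
      refine ex (q := fun (x : (((ℕ × β) × List β) × ℕ) × β) b' =>
        (x.1.1.2[x.1.2]? = some x.2 ∧ x.1.1.2[x.1.2 + 1]? = some b') ∧ step x.1.2 x.2 b') ?_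
      have hl : Primrec fun x : ((((ℕ × β) × List β) × ℕ) × β) × β => x.1.1.1.2 :=
        Primrec.snd.comp (Primrec.fst.comp (Primrec.fst.comp Primrec.fst))
      have hi : Primrec fun x : ((((ℕ × β) × List β) × ℕ) × β) × β => x.1.1.2 :=
        Primrec.snd.comp (Primrec.fst.comp Primrec.fst)
      refine and (of_primrec ((primrecPred_eq (Primrec.list_getElem?.comp hl hi)
        (Primrec.option_some.comp (Primrec.snd.comp Primrec.fst))).and
        (primrecPred_eq (Primrec.list_getElem?.comp hl (Primrec.succ.comp hi))
        (Primrec.option_some.comp Primrec.snd)))) ?_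
      exact h.comp ((hi.pair (Primrec.snd.comp Primrec.fst)).pair Primrec.snd)
  · rintro ⟨n, b⟩
    constructor
    · intro (hb : b = s n)
      subst hb
      refine ⟨(List.range (n + 1)).map s, by simp, by simp, fun i hi => ⟨s i, s (i + 1), ⟨?_, ?_⟩,
        (hs _ _).2 rfl⟩⟩
      · have : i < n := hi
        simp [show i < n + 1 by omega]
      · have : i < n := hi
        simp [this]
    · rintro ⟨l, h0, hn, hl⟩
      have key : ∀ i ≤ n, l[i]? = some (s i) := by
        intro i
        induction i with
        | zero => exact fun _ => h0
        | succ i ih =>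
          intro hi
          obtain ⟨b, b', ⟨h1, h2⟩, h3⟩ := hl i hi
          rw [ih (by omega), Option.some_inj] at h1
          subst h1
          rw [h2, (hs _ _).1 h3]
      have := key n le_rfl
      simp only at hn ⊢
      rw [hn] at this
      exact Option.some_inj.1 this

end REIn

/-! ### Certificates for oracle computations -/

namespace OCode

theorem encode_surjective : Function.Surjective encode := by
  intro e
  induction e using Nat.strong_induction_on with
  | _ e ih =>
    by_cases h : e < 5
    · interval_cases e
      exacts [⟨zero, rfl⟩, ⟨succ, rfl⟩, ⟨left, rfl⟩, ⟨right, rfl⟩, ⟨oracle, rfl⟩]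
    · obtain ⟨q, r, hr, rfl⟩ : ∃ q r, r < 4 ∧ e = 4 * q + r + 5 :=
        ⟨(e - 5) / 4, (e - 5) % 4, by omega, by omega⟩
      obtain ⟨c, hc⟩ := ih q.unpair.1 (by have := Nat.unpair_left_le q; omega)
      obtain ⟨d, hd⟩ := ih q.unpair.2 (by have := Nat.unpair_right_le q; omega)
      obtain ⟨f, hf⟩ := ih q (by omega)
      interval_cases r
      · exact ⟨pair c d, by simp [encode, hc, hd]⟩
      · exact ⟨comp c d, by simp [encode, hc, hd]⟩
      · exact ⟨prec c d, by simp [encode, hc, hd]⟩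
      · exact ⟨rfind f, by simp [encode, hf]⟩

/-- The program with constant value `k`. -/
def const : ℕ → OCode
  | 0 => zero
  | k + 1 => comp succ (const k)

theorem eval_const (X : Set ℕ) (k n : ℕ) : (const k).eval X n = Part.some k := by
  induction k with
  | zero => rfl
  | succ k ih => simp [const, eval, ih]

theorem primrec_encode_const : Primrec fun k => (const k).encode := by
  refine (Primrec.nat_rec₁ (f := fun _ i => 4 * Nat.pair 1 i + 6) 0 ?_).of_eq fun k => ?_
  · exact (Primrec.nat_add.comp (Primrec.nat_mul.comp (Primrec.const 4)
      (Primrec₂.natPair.comp (Primrec.const 1) Primrec.snd)) (Primrec.const 6)).to₂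
  · induction k with
    | zero => rfl
    | succ k ih => simp only [const, encode, ← ih]

end OCode

/-- The fact `(e, n, y)` follows, by one of the rules that define `OCode.eval`, from the oracle
segment `σ` and the facts in `D`. A fact `(e, n, y)` stands for `Φ_e(n) = y`, where `e` is the
number of the program. There is one disjunct for each clause of `OCode.eval`, in the same order,
except that `prec` has two, for the base case and for the successor step. -/
def Justified (σ : List Bool) (D : List (ℕ × ℕ × ℕ)) (t : ℕ × ℕ × ℕ) : Prop :=
  (t.1 = 0 ∧ t.2.2 = 0) ∨ (t.1 = 1 ∧ t.2.2 = t.2.1 + 1) ∨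
  (t.1 = 2 ∧ t.2.2 = t.2.1.unpair.1) ∨ (t.1 = 3 ∧ t.2.2 = t.2.1.unpair.2) ∨
  (t.1 = 4 ∧ σ[t.2.1]?.map Bool.toNat = some t.2.2) ∨
  (∃ p ∈ D, ∃ q ∈ D,
    t = (4 * Nat.pair p.1 q.1 + 5, p.2.1, Nat.pair p.2.2 q.2.2) ∧ q.2.1 = p.2.1) ∨
  (∃ p ∈ D, ∃ q ∈ D, t = (4 * Nat.pair q.1 p.1 + 6, p.2.1, q.2.2) ∧ q.2.1 = p.2.2) ∨
  (∃ p ∈ D, ∃ h < t.1, t = (4 * Nat.pair p.1 h + 7, Nat.pair p.2.1 0, p.2.2)) ∨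
  (∃ p ∈ D, ∃ q ∈ D, p.1 = t.1 ∧
    t.2 = (Nat.pair p.2.1.unpair.1 (p.2.1.unpair.2 + 1), q.2.2) ∧
    q.2.1 = Nat.pair p.2.1.unpair.1 (Nat.pair p.2.1.unpair.2 p.2.2) ∧
    ∃ f < t.1, t.1 = 4 * Nat.pair f q.1 + 7) ∨
  (∃ q ∈ D, t.1 = 4 * q.1 + 8 ∧ q.2 = (Nat.pair t.2.1 t.2.2, 0) ∧
    ∀ i < t.2.2, ∃ p ∈ D, p.1 = q.1 ∧ p.2.1 = Nat.pair t.2.1 i ∧ p.2.2 ≠ 0)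

theorem Justified.mono {σ τ : List Bool} {D E : List (ℕ × ℕ × ℕ)} {t : ℕ × ℕ × ℕ} (h : σ <+: τ)
    (hD : D ⊆ E) (hj : Justified σ D t) : Justified τ E t := by
  rcases hj with h1 | h1 | h1 | h1 | ⟨h1, h2⟩ | ⟨p, hp, q, hq, h1⟩ | ⟨p, hp, q, hq, h1⟩ |
    ⟨p, hp, h1⟩ | ⟨p, hp, q, hq, h1⟩ | ⟨q, hq, h1, h2, h3⟩
  · exact .inl h1
  · exact .inr <| .inl h1
  · exact .inr <| .inr <| .inl h1
  · exact .inr <| .inr <| .inr <| .inl h1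
  · refine .inr <| .inr <| .inr <| .inr <| .inl ⟨h1, ?_⟩
    obtain ⟨b, hb, hb'⟩ := Option.map_eq_some_iff.1 h2
    obtain ⟨ρ, rfl⟩ := h
    rw [List.getElem?_append_left (List.getElem?_eq_some_iff.1 hb).1, hb, Option.map_some, hb']
  · exact .inr <| .inr <| .inr <| .inr <| .inr <| .inl ⟨p, hD hp, q, hD hq, h1⟩
  · exact .inr <| .inr <| .inr <| .inr <| .inr <| .inr <| .inl ⟨p, hD hp, q, hD hq, h1⟩
  · exact .inr <| .inr <| .inr <| .inr <| .inr <| .inr <| .inr <| .inl ⟨p, hD hp, h1⟩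
  · exact .inr <| .inr <| .inr <| .inr <| .inr <| .inr <| .inr <| .inr <| .inl
      ⟨p, hD hp, q, hD hq, h1⟩
  · refine .inr <| .inr <| .inr <| .inr <| .inr <| .inr <| .inr <| .inr <| .inr
      ⟨q, hD hq, h1, h2, fun i hi => ?_⟩
    obtain ⟨p, hp, h⟩ := h3 i hi
    exact ⟨p, hD hp, h⟩

theorem primrecPred_justified :
    PrimrecPred fun x : (List Bool × List (ℕ × ℕ × ℕ)) × (ℕ × ℕ × ℕ) =>
      Justified x.1.1 x.1.2 x.2 := by
  have F1 : Primrec fun t : ℕ × ℕ × ℕ => t.1 := Primrec.fst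
  have F2 : Primrec fun t : ℕ × ℕ × ℕ => t.2.1 := Primrec.fst.comp Primrec.snd
  have F3 : Primrec fun t : ℕ × ℕ × ℕ => t.2.2 := Primrec.snd.comp Primrec.snd
  have U1 : Primrec fun n : ℕ => n.unpair.1 := Primrec.fst.comp Primrec.unpair
  have U2 : Primrec fun n : ℕ => n.unpair.2 := Primrec.snd.comp Primrec.unpair
  have lin (r : ℕ) : Primrec fun n : ℕ => 4 * n + r :=
    Primrec.nat_add.comp (Primrec.nat_mul.comp (Primrec.const 4) Primrec.id) (Primrec.const r)
  have T : Primrec fun x : (List Bool × List (ℕ × ℕ × ℕ)) × (ℕ × ℕ × ℕ) => x.2 := Primrec.snd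
  have S : Primrec fun x : (List Bool × List (ℕ × ℕ × ℕ)) × (ℕ × ℕ × ℕ) => x.1.1 :=
    Primrec.fst.comp Primrec.fst
  have D : Primrec fun x : (List Bool × List (ℕ × ℕ × ℕ)) × (ℕ × ℕ × ℕ) => x.1.2 :=
    Primrec.snd.comp Primrec.fst
  have two {Q : ℕ × ℕ × ℕ → ℕ × ℕ × ℕ → ℕ × ℕ × ℕ → Prop}
      (hQ : PrimrecPred fun x : ((ℕ × ℕ × ℕ) × (ℕ × ℕ × ℕ)) × (ℕ × ℕ × ℕ) => Q x.1.1 x.1.2 x.2) :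
      PrimrecPred fun x : (List Bool × List (ℕ × ℕ × ℕ)) × (ℕ × ℕ × ℕ) =>
        ∃ p ∈ x.1.2, ∃ q ∈ x.1.2, Q x.2 p q := by
    refine primrecPred_exists_mem
      (q := fun (x : (List Bool × List (ℕ × ℕ × ℕ)) × (ℕ × ℕ × ℕ)) p => ∃ q ∈ x.1.2, Q x.2 p q)
      D ?_
    refine primrecPred_exists_mem
      (q := fun (x : ((List Bool × List (ℕ × ℕ × ℕ)) × (ℕ × ℕ × ℕ)) × (ℕ × ℕ × ℕ)) q =>
        Q x.1.2 x.2 q) (D.comp Primrec.fst) ?_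
    exact hQ.comp (((T.comp (Primrec.fst.comp Primrec.fst)).pair
      (Primrec.snd.comp Primrec.fst)).pair Primrec.snd)
  have A : Primrec fun x : ((ℕ × ℕ × ℕ) × (ℕ × ℕ × ℕ)) × (ℕ × ℕ × ℕ) => x.1.1 :=
    Primrec.fst.comp Primrec.fst
  have P : Primrec fun x : ((ℕ × ℕ × ℕ) × (ℕ × ℕ × ℕ)) × (ℕ × ℕ × ℕ) => x.1.2 :=
    Primrec.snd.comp Primrec.fst
  have Q : Primrec fun x : ((ℕ × ℕ × ℕ) × (ℕ × ℕ × ℕ)) × (ℕ × ℕ × ℕ) => x.2 := Primrec.snd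
  refine .or ?_ (.or ?_ (.or ?_ (.or ?_ (.or ?_ (.or ?_ (.or ?_ (.or ?_ (.or ?_ ?_))))))))
  · exact (primrecPred_eq (F1.comp T) (Primrec.const 0)).and
      (primrecPred_eq (F3.comp T) (Primrec.const 0))
  · exact (primrecPred_eq (F1.comp T) (Primrec.const 1)).and
      (primrecPred_eq (F3.comp T) (Primrec.succ.comp (F2.comp T)))
  · exact (primrecPred_eq (F1.comp T) (Primrec.const 2)).and
      (primrecPred_eq (F3.comp T) (U1.comp (F2.comp T)))
  · exact (primrecPred_eq (F1.comp T) (Primrec.const 3)).and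
      (primrecPred_eq (F3.comp T) (U2.comp (F2.comp T)))
  · exact (primrecPred_eq (F1.comp T) (Primrec.const 4)).and
      (primrecPred_eq (Primrec.option_map (Primrec.list_getElem?.comp S (F2.comp T))
        ((Primrec.dom_bool Bool.toNat).comp Primrec.snd).to₂)
        (Primrec.option_some.comp (F3.comp T)))
  · exact two (Q := fun t p q =>
      t = (4 * Nat.pair p.1 q.1 + 5, p.2.1, Nat.pair p.2.2 q.2.2) ∧ q.2.1 = p.2.1)
      ((primrecPred_eq A (((lin 5).comp (Primrec₂.natPair.comp (F1.comp P) (F1.comp Q))).pair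
        ((F2.comp P).pair (Primrec₂.natPair.comp (F3.comp P) (F3.comp Q))))).and
        (primrecPred_eq (F2.comp Q) (F2.comp P)))
  · exact two (Q := fun t p q => t = (4 * Nat.pair q.1 p.1 + 6, p.2.1, q.2.2) ∧ q.2.1 = p.2.2)
      ((primrecPred_eq A (((lin 6).comp (Primrec₂.natPair.comp (F1.comp Q) (F1.comp P))).pair
        ((F2.comp P).pair (F3.comp Q)))).and
        (primrecPred_eq (F2.comp Q) (F3.comp P)))
  · refine primrecPred_exists_mem
      (q := fun (x : (List Bool × List (ℕ × ℕ × ℕ)) × (ℕ × ℕ × ℕ)) p => ∃ h < x.2.1,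
        x.2 = (4 * Nat.pair p.1 h + 7, Nat.pair p.2.1 0, p.2.2)) D ?_
    refine primrecPred_exists_lt
      (q := fun (x : ((List Bool × List (ℕ × ℕ × ℕ)) × (ℕ × ℕ × ℕ)) × (ℕ × ℕ × ℕ)) h =>
        x.1.2 = (4 * Nat.pair x.2.1 h + 7, Nat.pair x.2.2.1 0, x.2.2.2))
      (F1.comp (T.comp Primrec.fst)) ?_
    have P' : Primrec fun x : (((List Bool × List (ℕ × ℕ × ℕ)) × (ℕ × ℕ × ℕ)) × (ℕ × ℕ × ℕ)) × ℕ =>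
      x.1.2 := Primrec.snd.comp Primrec.fst
    exact primrecPred_eq (T.comp (Primrec.fst.comp Primrec.fst))
      (((lin 7).comp (Primrec₂.natPair.comp (F1.comp P') Primrec.snd)).pair
        ((Primrec₂.natPair.comp (F2.comp P') (Primrec.const 0)).pair (F3.comp P')))
  · refine two (Q := fun t p q => p.1 = t.1 ∧
      t.2 = (Nat.pair p.2.1.unpair.1 (p.2.1.unpair.2 + 1), q.2.2) ∧
      q.2.1 = Nat.pair p.2.1.unpair.1 (Nat.pair p.2.1.unpair.2 p.2.2) ∧
      ∃ f < t.1, t.1 = 4 * Nat.pair f q.1 + 7) ?_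
    refine (primrecPred_eq (F1.comp P) (F1.comp A)).and ((primrecPred_eq (Primrec.snd.comp A)
      ((Primrec₂.natPair.comp (U1.comp (F2.comp P))
        (Primrec.succ.comp (U2.comp (F2.comp P)))).pair (F3.comp Q))).and
      ((primrecPred_eq (F2.comp Q) (Primrec₂.natPair.comp (U1.comp (F2.comp P))
        (Primrec₂.natPair.comp (U2.comp (F2.comp P)) (F3.comp P)))).and ?_))
    refine primrecPred_exists_lt (q := fun (x : ((ℕ × ℕ × ℕ) × (ℕ × ℕ × ℕ)) × (ℕ × ℕ × ℕ)) f =>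
      x.1.1.1 = 4 * Nat.pair f x.2.1 + 7) (F1.comp A) ?_
    exact primrecPred_eq (F1.comp (A.comp Primrec.fst))
      ((lin 7).comp (Primrec₂.natPair.comp Primrec.snd (F1.comp (Q.comp Primrec.fst))))
  · refine primrecPred_exists_mem
      (q := fun (x : (List Bool × List (ℕ × ℕ × ℕ)) × (ℕ × ℕ × ℕ)) q => x.2.1 = 4 * q.1 + 8 ∧
        q.2 = (Nat.pair x.2.2.1 x.2.2.2, 0) ∧ ∀ i < x.2.2.2, ∃ p ∈ x.1.2,
          p.1 = q.1 ∧ p.2.1 = Nat.pair x.2.2.1 i ∧ p.2.2 ≠ 0) D ?_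
    refine (primrecPred_eq (F1.comp (T.comp Primrec.fst))
      ((lin 8).comp (F1.comp Primrec.snd))).and ((primrecPred_eq (Primrec.snd.comp Primrec.snd)
      ((Primrec₂.natPair.comp (F2.comp (T.comp Primrec.fst)) (F3.comp (T.comp Primrec.fst))).pair
        (Primrec.const 0))).and ?_)
    refine primrecPred_forall_lt
      (q := fun (x : ((List Bool × List (ℕ × ℕ × ℕ)) × (ℕ × ℕ × ℕ)) × (ℕ × ℕ × ℕ)) i =>
        ∃ p ∈ x.1.1.2, p.1 = x.2.1 ∧ p.2.1 = Nat.pair x.1.2.2.1 i ∧ p.2.2 ≠ 0)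
      (F3.comp (T.comp Primrec.fst)) ?_
    refine primrecPred_exists_mem
      (q := fun (x : (((List Bool × List (ℕ × ℕ × ℕ)) × (ℕ × ℕ × ℕ)) × (ℕ × ℕ × ℕ)) × ℕ) p =>
        p.1 = x.1.2.1 ∧ p.2.1 = Nat.pair x.1.1.2.2.1 x.2 ∧ p.2.2 ≠ 0)
      (D.comp (Primrec.fst.comp Primrec.fst)) ?_
    exact (primrecPred_eq (F1.comp Primrec.snd)
      (F1.comp (Primrec.snd.comp (Primrec.fst.comp Primrec.fst)))).and ((primrecPred_eq
        (F2.comp Primrec.snd) (Primrec₂.natPair.comp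
          (F2.comp (T.comp (Primrec.fst.comp (Primrec.fst.comp Primrec.fst))))
          (Primrec.snd.comp Primrec.fst))).and
      (primrecPred_eq (F3.comp Primrec.snd) (Primrec.const 0)).not)

/-- `D` is a derivation from the oracle segment `σ`: every fact of `D` is justified by the facts
that come after it. -/
def IsDerivation (σ : List Bool) (D : List (ℕ × ℕ × ℕ)) : Prop :=
  ∀ i < D.length, ∃ t ∈ D[i]?, Justified σ (D.drop (i + 1)) t

theorem primrecPred_isDerivation :
    PrimrecPred fun x : List Bool × List (ℕ × ℕ × ℕ) => IsDerivation x.1 x.2 := by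
  refine primrecPred_forall_lt (q := fun (x : List Bool × List (ℕ × ℕ × ℕ)) i =>
    ∃ t ∈ x.2[i]?, Justified x.1 (x.2.drop (i + 1)) t) (Primrec.list_length.comp Primrec.snd) ?_
  refine primrecPred_exists_mem_option (q := fun (x : (List Bool × List (ℕ × ℕ × ℕ)) × ℕ) t =>
    Justified x.1.1 (x.1.2.drop (x.2 + 1)) t)
    (Primrec.list_getElem?.comp (Primrec.snd.comp Primrec.fst) Primrec.snd) ?_
  exact primrecPred_justified.comp (((Primrec.fst.comp (Primrec.fst.comp Primrec.fst)).pair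
    (Primrec.list_drop.comp (Primrec.succ.comp (Primrec.snd.comp Primrec.fst))
      (Primrec.snd.comp (Primrec.fst.comp Primrec.fst)))).pair Primrec.snd)

namespace IsDerivation

variable {σ τ : List Bool} {D E : List (ℕ × ℕ × ℕ)} {t : ℕ × ℕ × ℕ}

theorem nil : IsDerivation σ [] := by simp [IsDerivation]

theorem cons_iff : IsDerivation σ (t :: D) ↔ Justified σ D t ∧ IsDerivation σ D := by
  constructor
  · intro h
    refine ⟨by simpa using h 0, fun i hi => by simpa using h (i + 1) (by simpa using hi)⟩
  · rintro ⟨h, h'⟩ (_ | i) hi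
    · simpa using h
    · simpa using h' i (by simpa using hi)

theorem mono (h : σ <+: τ) (hD : IsDerivation σ D) : IsDerivation τ D := fun i hi => by
  obtain ⟨t, ht, hj⟩ := hD i hi
  exact ⟨t, ht, hj.mono h fun _ => id⟩

theorem append (hD : IsDerivation σ D) (hE : IsDerivation σ E) : IsDerivation σ (D ++ E) := by
  induction D with
  | nil => exact hE
  | cons t D ih =>
    rw [cons_iff] at hD
    exact cons_iff.2 ⟨hD.1.mono (List.prefix_refl σ) (List.subset_append_left _ _), ih hD.2⟩

/-- Derivations from initial segments of `X` derive only true facts. -/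
theorem sound {X : Set ℕ} {N : ℕ} (hD : IsDerivation (seg X N) D) (ht : t ∈ D) :
    ∃ c : OCode, c.encode = t.1 ∧ t.2.2 ∈ c.eval X t.2.1 := by
  induction D generalizing t with
  | nil => simp at ht
  | cons s D ih =>
    rw [cons_iff] at hD
    rcases List.mem_cons.1 ht with rfl | ht
    swap
    · exact ih hD.2 ht
    replace ih := fun {s} => ih (t := s) hD.2
    rcases hD.1 with h1 | h1 | h1 | h1 | ⟨h1, h2⟩ | ⟨p, hp, q, hq, rfl, h1⟩ |
      ⟨p, hp, q, hq, rfl, h1⟩ | ⟨p, hp, h, -, h1⟩ | ⟨p, hp, q, hq, h1, h2, h3, f, -, h4⟩ |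
      ⟨q, hq, h1, h2, h3⟩
    · exact ⟨.zero, h1.1.symm, by simp [h1.2, OCode.eval]⟩
    · exact ⟨.succ, h1.1.symm, by simp [h1.2, OCode.eval]⟩
    · exact ⟨.left, h1.1.symm, by simp [h1.2, OCode.eval]⟩
    · exact ⟨.right, h1.1.symm, by simp [h1.2, OCode.eval]⟩
    · refine ⟨.oracle, h1.symm, ?_⟩
      obtain ⟨b, hb, hb'⟩ := Option.map_eq_some_iff.1 h2
      rw [← hb']
      cases b
      · simp [OCode.eval, chi, (seg_getElem?_false.1 hb).2]
      · simp [OCode.eval, chi, (seg_getElem?_true.1 hb).2]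
    · obtain ⟨c, hc, hc'⟩ := ih hp
      obtain ⟨d, hd, hd'⟩ := ih hq
      refine ⟨.pair c d, by simp [OCode.encode, hc, hd], ?_⟩
      rw [h1] at hd'
      simp only [OCode.eval, Seq.seq, Part.mem_bind_iff, Part.map_eq_map, Part.mem_map_iff]
      exact ⟨_, ⟨_, hc', rfl⟩, _, hd', rfl⟩
    · obtain ⟨c, hc, hc'⟩ := ih hp
      obtain ⟨d, hd, hd'⟩ := ih hq
      refine ⟨.comp d c, by simp [OCode.encode, hc, hd], ?_⟩
      rw [h1] at hd'
      exact Part.mem_bind_iff.2 ⟨_, hc', hd'⟩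
    · obtain ⟨c, hc, hc'⟩ := ih hp
      obtain ⟨d, rfl⟩ := OCode.encode_surjective h
      rw [h1]
      exact ⟨.prec c d, by simp [OCode.encode, hc], by simpa [OCode.eval] using hc'⟩
    · obtain ⟨c, hc, hc'⟩ := ih hp
      obtain ⟨d, hd, hd'⟩ := ih hq
      obtain ⟨f, rfl⟩ := OCode.encode_surjective f
      have hcf : c = .prec f d := OCode.encode_injective (by rw [hc, h1, h4, ← hd]; rfl)
      refine ⟨c, by rw [hc, h1], ?_⟩
      subst hcf
      rw [h2]
      rw [h3] at hd'
      simp only [OCode.eval, Nat.unpair_pair] at hc' ⊢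
      exact Part.mem_bind_iff.2 ⟨_, hc', hd'⟩
    · obtain ⟨c, hc, hc'⟩ := ih hq
      refine ⟨.rfind c, by simp [OCode.encode, hc, h1], ?_⟩
      rw [h2] at hc'
      refine Nat.mem_rfind.2 ⟨(Part.mem_map_iff _).2 ⟨_, hc', by simp⟩,
        fun {i} hi => (Part.mem_map_iff _).2 ?_⟩
      obtain ⟨p, hp, hp1, hp2, hp3⟩ := h3 i hi
      obtain ⟨d, hd, hd'⟩ := ih hp
      obtain rfl : c = d := OCode.encode_injective (by rw [hc, hd, hp1])
      rw [hp2] at hd'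
      exact ⟨_, hd', by simpa using hp3⟩

end IsDerivation

/-- The fact `t` has a derivation from an initial segment of `X`. -/
def Derivable (X : Set ℕ) (t : ℕ × ℕ × ℕ) : Prop :=
  ∃ N D, IsDerivation (seg X N) D ∧ t ∈ D

/-- Derivable facts are closed under the rules, since finitely many derivations can be
concatenated. -/
theorem Derivable.of_justified {X : Set ℕ} {N : ℕ} {t : ℕ × ℕ × ℕ} {S : List (ℕ × ℕ × ℕ)}
    (hS : ∀ s ∈ S, Derivable X s) (ht : Justified (seg X N) S t) : Derivable X t := by
  obtain ⟨M, D, hD, hSD⟩ : ∃ M D, IsDerivation (seg X M) D ∧ ∀ s ∈ S, s ∈ D := by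
    clear ht
    induction S with
    | nil => exact ⟨0, [], .nil, by simp⟩
    | cons s S ih =>
      obtain ⟨M, D, hD, h⟩ := ih fun s hs => hS s (by simp [hs])
      obtain ⟨K, E, hE, h'⟩ := hS s (by simp)
      refine ⟨max K M, E ++ D, (hE.mono (seg_prefix_seg X (le_max_left _ _))).append
        (hD.mono (seg_prefix_seg X (le_max_right _ _))), fun r hr => ?_⟩
      rcases List.mem_cons.1 hr with rfl | hr
      · exact List.mem_append_left _ h'
      · exact List.mem_append_right _ (h r hr)
  exact ⟨max N M, t :: D, IsDerivation.cons_iff.2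
    ⟨ht.mono (seg_prefix_seg X (le_max_left _ _)) hSD,
      hD.mono (seg_prefix_seg X (le_max_right _ _))⟩, by simp⟩

/-- Every true fact is derivable. -/
theorem derivable_of_mem_eval {X : Set ℕ} {c : OCode} {n y : ℕ} (h : y ∈ c.eval X n) :
    Derivable X (c.encode, n, y) := by
  induction c generalizing n y with
  | zero =>
    refine .of_justified (N := 0) (S := []) (by simp) (.inl ⟨rfl, ?_⟩)
    simpa [OCode.eval] using h
  | succ =>
    refine .of_justified (N := 0) (S := []) (by simp) (.inr <| .inl ⟨rfl, ?_⟩)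
    simpa [OCode.eval] using h
  | left =>
    refine .of_justified (N := 0) (S := []) (by simp) (.inr <| .inr <| .inl ⟨rfl, ?_⟩)
    simpa [OCode.eval] using h
  | right =>
    refine .of_justified (N := 0) (S := []) (by simp) (.inr <| .inr <| .inr <| .inl ⟨rfl, ?_⟩)
    simpa [OCode.eval] using h
  | oracle =>
    refine .of_justified (N := n + 1) (S := []) (by simp)
      (.inr <| .inr <| .inr <| .inr <| .inl ⟨rfl, ?_⟩)
    simp only [OCode.eval, chi, Part.mem_some_iff] at h
    by_cases hn : n ∈ X
    · rw [seg_getElem?_true.2 ⟨Nat.lt_succ_self n, hn⟩]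
      simp [h, hn]
    · rw [seg_getElem?_false.2 ⟨Nat.lt_succ_self n, hn⟩]
      simp [h, hn]
  | pair f g ihf ihg =>
    simp only [OCode.eval, Seq.seq, Part.mem_bind_iff, Part.map_eq_map, Part.mem_map_iff] at h
    obtain ⟨_, ⟨a, ha, rfl⟩, b, hb, rfl⟩ := h
    refine .of_justified (N := 0) (S := [(f.encode, n, a), (g.encode, n, b)]) ?_
      (.inr <| .inr <| .inr <| .inr <| .inr <| .inl ⟨(f.encode, n, a), by simp,
        (g.encode, n, b), by simp, rfl, rfl⟩)
    simp only [List.mem_cons, List.not_mem_nil, or_false]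
    rintro _ (rfl | rfl)
    exacts [ihf ha, ihg hb]
  | comp f g ihf ihg =>
    obtain ⟨a, ha, hb⟩ := Part.mem_bind_iff.1 h
    refine .of_justified (N := 0) (S := [(g.encode, n, a), (f.encode, a, y)]) ?_
      (.inr <| .inr <| .inr <| .inr <| .inr <| .inr <| .inl ⟨(g.encode, n, a), by simp,
        (f.encode, a, y), by simp, rfl, rfl⟩)
    simp only [List.mem_cons, List.not_mem_nil, or_false]
    rintro _ (rfl | rfl)
    exacts [ihg ha, ihf hb]
  | prec f g ihf ihg =>
    obtain ⟨a, k, rfl⟩ : ∃ a k, n = Nat.pair a k := ⟨_, _, (Nat.pair_unpair n).symm⟩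
    have hfe : ∀ u v, u < 4 * Nat.pair u v + 7 ∧ v < 4 * Nat.pair u v + 7 := fun u v => by
      have := Nat.left_le_pair u v
      have := Nat.right_le_pair u v
      omega
    induction k generalizing y with
    | zero =>
      simp only [OCode.eval, Nat.unpair_pair] at h
      refine .of_justified (N := 0) (S := [(f.encode, a, y)]) (by simpa using ihf h)
        (.inr <| .inr <| .inr <| .inr <| .inr <| .inr <| .inr <| .inl ⟨_, List.mem_singleton_self _,
          g.encode, (hfe _ _).2, rfl⟩)
    | succ k ih =>
      simp only [OCode.eval, Nat.unpair_pair] at h ih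
      obtain ⟨i, hi, hy⟩ := Part.mem_bind_iff.1 h
      refine .of_justified (N := 0) (S := [((OCode.prec f g).encode, Nat.pair a k, i),
        (g.encode, Nat.pair a (Nat.pair k i), y)]) ?_
        (.inr <| .inr <| .inr <| .inr <| .inr <| .inr <| .inr <| .inr <| .inl
          ⟨((OCode.prec f g).encode, Nat.pair a k, i), by simp,
            (g.encode, Nat.pair a (Nat.pair k i), y), by simp, rfl, by simp, by simp,
            f.encode, (hfe _ _).1, rfl⟩)
      simp only [List.mem_cons, List.not_mem_nil, or_false]
      rintro _ (rfl | rfl)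
      exacts [ih hi, ihg hy]
  | rfind f ih =>
    obtain ⟨h0, hlt⟩ := Nat.mem_rfind.1 h
    obtain ⟨z, hz, hz'⟩ := (Part.mem_map_iff _).1 h0
    obtain rfl : z = 0 := by simpa using hz'
    have : ∀ i, ∃ w, i < y → w ∈ f.eval X (Nat.pair n i) ∧ w ≠ 0 := fun i => by
      by_cases hi : i < y
      · obtain ⟨w, hw, hw'⟩ := (Part.mem_map_iff _).1 (hlt hi)
        exact ⟨w, fun _ => ⟨hw, by simpa using hw'⟩⟩
      · exact ⟨0, fun h => absurd h hi⟩
    choose w hw using this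
    refine .of_justified (N := 0) (S := (f.encode, Nat.pair n y, 0) ::
      (List.range y).map fun i => (f.encode, Nat.pair n i, w i)) ?_
      (.inr <| .inr <| .inr <| .inr <| .inr <| .inr <| .inr <| .inr <| .inr
        ⟨(f.encode, Nat.pair n y, 0), by simp, rfl, rfl, fun i hi =>
          ⟨(f.encode, Nat.pair n i, w i), ?_, rfl, rfl, (hw i hi).2⟩⟩)
    · simp only [List.mem_cons, List.mem_map, List.mem_range]
      rintro _ (rfl | ⟨i, hi, rfl⟩)
      exacts [ih hz, ih (hw i hi).1]
    · simp only [List.mem_cons, List.mem_map, List.mem_range]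
      exact .inr ⟨i, hi, rfl⟩

theorem mem_eval_iff_derivable {X : Set ℕ} {c : OCode} {n y : ℕ} :
    y ∈ c.eval X n ↔ Derivable X (c.encode, n, y) := by
  refine ⟨derivable_of_mem_eval, fun ⟨N, D, hD, ht⟩ => ?_⟩
  obtain ⟨d, hd, h⟩ := hD.sound ht
  rwa [OCode.encode_injective hd] at h

/-- **Enumeration theorem**: the universal partial function with oracle `X` has a graph that is
r.e. in `X`. -/
theorem REIn.derivable (X : Set ℕ) : REIn X (Derivable X) := by
  refine REIn.of_iff (p := fun t => ∃ D, ∃ N, IsDerivation (seg X N) D ∧ t ∈ D) (.ex ?_)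
    fun t => exists_comm
  refine ⟨fun x σ => IsDerivation σ x.2 ∧ x.1 ∈ x.2, ?_, fun x => Iff.rfl⟩
  refine (primrecPred_isDerivation.comp (Primrec.snd.pair (Primrec.snd.comp Primrec.fst))).and ?_
  exact (primrecPred_exists_mem (q := fun (x : ((ℕ × ℕ × ℕ) × List (ℕ × ℕ × ℕ)) × List Bool) t =>
    t = x.1.1) (Primrec.snd.comp Primrec.fst) (primrecPred_eq Primrec.snd
      (Primrec.fst.comp (Primrec.fst.comp Primrec.fst)))).of_eq (by simp)

theorem REIn.mem_eval (X : Set ℕ) (c : OCode) : REIn X fun x : ℕ × ℕ => x.2 ∈ c.eval X x.1 :=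
  ((REIn.derivable X).comp ((Primrec.const c.encode).pair Primrec.id)).of_iff
    fun _ => mem_eval_iff_derivable

theorem REIn.jump (X : Set ℕ) : REIn X (· ∈ jump X) := by
  refine of_iff (p := fun e => ∃ y, Derivable X (e, e, y)) (.ex ?_) fun e => ?_
  · exact (REIn.derivable X).comp (Primrec.fst.pair (Primrec.fst.pair Primrec.snd))
  · obtain ⟨c, rfl⟩ := OCode.encode_surjective e
    simp only [← mem_eval_iff_derivable, ← Part.dom_iff_mem]
    exact ⟨fun ⟨d, hd, h⟩ => OCode.encode_injective hd ▸ h, fun h => ⟨c, rfl, h⟩⟩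

/-- With oracle segment `σ`, the computation `Φ_e(e)` is seen to halt within `|σ|` steps: it has a
derivation whose code is less than `|σ|`. The relation is primitive recursive and persists under
end extension of `σ`. As `e < |σ|` is required, only finitely many computations halt on a given
`σ`. -/
def HaltsOn (σ : List Bool) (e : ℕ) : Prop :=
  e < σ.length ∧ ∃ k < σ.length, ∃ D ∈ (decode k : Option (List (ℕ × ℕ × ℕ))),
    IsDerivation σ D ∧ ∃ t ∈ D, t.1 = e ∧ t.2.1 = e

theorem HaltsOn.mono {σ τ : List Bool} {e : ℕ} (h : σ <+: τ) (hσ : HaltsOn σ e) : HaltsOn τ e := by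
  obtain ⟨he, k, hk, D, hD, hD', ht⟩ := hσ
  have := h.length_le
  exact ⟨by omega, k, by omega, D, hD, hD'.mono h, ht⟩

theorem primrecPred_haltsOn : PrimrecPred fun x : List Bool × ℕ => HaltsOn x.1 x.2 := by
  refine (Primrec.nat_lt.comp Primrec.snd (Primrec.list_length.comp Primrec.fst)).and ?_
  refine primrecPred_exists_lt (q := fun (x : List Bool × ℕ) k =>
    ∃ D ∈ (decode k : Option (List (ℕ × ℕ × ℕ))),
      IsDerivation x.1 D ∧ ∃ t ∈ D, t.1 = x.2 ∧ t.2.1 = x.2)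
    (Primrec.list_length.comp Primrec.fst) ?_
  refine primrecPred_exists_mem_option (q := fun (x : (List Bool × ℕ) × ℕ) D =>
      IsDerivation x.1.1 D ∧ ∃ t ∈ D, t.1 = x.1.2 ∧ t.2.1 = x.1.2)
    (Primrec.decode.comp Primrec.snd) ?_
  refine (primrecPred_isDerivation.comp
    ((Primrec.fst.comp (Primrec.fst.comp Primrec.fst)).pair Primrec.snd)).and ?_
  refine primrecPred_exists_mem
    (q := fun (x : ((List Bool × ℕ) × ℕ) × List (ℕ × ℕ × ℕ)) t =>
      t.1 = x.1.1.2 ∧ t.2.1 = x.1.1.2) Primrec.snd ?_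
  have E : Primrec fun x : (((List Bool × ℕ) × ℕ) × List (ℕ × ℕ × ℕ)) × (ℕ × ℕ × ℕ) =>
      x.1.1.1.2 := Primrec.snd.comp (Primrec.fst.comp (Primrec.fst.comp Primrec.fst))
  exact (primrecPred_eq (Primrec.fst.comp Primrec.snd) E).and
    (primrecPred_eq (Primrec.fst.comp (Primrec.snd.comp Primrec.snd)) E)

theorem mem_jump_iff_haltsOn {X : Set ℕ} {e : ℕ} :
    e ∈ jump X ↔ ∃ N, HaltsOn (seg X N) e := by
  constructor
  · rintro ⟨c, rfl, h⟩
    obtain ⟨y, hy⟩ := Part.dom_iff_mem.1 h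
    obtain ⟨N, D, hD, ht⟩ := derivable_of_mem_eval hy
    refine ⟨max N (max (c.encode + 1) (Encodable.encode D + 1)), ?_, Encodable.encode D, ?_, D,
      by simp, hD.mono (seg_prefix_seg X (le_max_left _ _)), _, ht, rfl, rfl⟩
    all_goals
      rw [length_seg]
      omega
  · rintro ⟨N, -, k, -, D, -, hD, ⟨e', n, y⟩, ht, rfl, h⟩
    obtain ⟨c, hc, hy⟩ := hD.sound ht
    simp only at h hc hy
    subst h
    exact ⟨c, hc, Part.dom_iff_mem.2 ⟨y, hy⟩⟩

/-! ### Programs from r.e. relations -/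

/-- The total function `f` is computed by some program with oracle `X`. -/
def RecFun (X : Set ℕ) (f : ℕ → ℕ) : Prop := Nat.RecursiveIn {chi X} fun n => Part.some (f n)

namespace RecFun

variable {X : Set ℕ} {f g h : ℕ → ℕ}

theorem of_primrec (hf : Primrec f) : RecFun X f :=
  Nat.Primrec.recursiveIn (Primrec.nat_iff.1 hf)

theorem comp (hf : RecFun X f) (hg : RecFun X g) : RecFun X fun n => f (g n) :=
  (Nat.RecursiveIn.comp hf hg).of_eq fun n => by simp

theorem pair (hf : RecFun X f) (hg : RecFun X g) : RecFun X fun n => Nat.pair (f n) (g n) :=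
  (Nat.RecursiveIn.pair hf hg).of_eq fun n => by simp [Seq.seq]

theorem prec (hf : RecFun X f) (hh : RecFun X h) : RecFun X fun p =>
    Nat.rec (f p.unpair.1) (fun y i => h (Nat.pair p.unpair.1 (Nat.pair y i))) p.unpair.2 :=
  (Nat.RecursiveIn.prec hf hh).of_eq fun p => by
    simp only
    induction p.unpair.2 with
    | zero => rfl
    | succ k ih => simp only [ih]; simp

theorem encode_seg (X : Set ℕ) : RecFun X fun k => encode (seg X k) := by
  classical
  have hchi : RecFun X fun n => if n ∈ X then 1 else 0 := Nat.RecursiveIn.oracle _ rfl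
  have hstep : RecFun X fun m : ℕ => encode
      (((decode m.unpair.1 : Option (List Bool)).getD []) ++ [m.unpair.2 == 1]) := by
    refine of_primrec (Primrec.encode.comp (Primrec.list_append.comp
      (Primrec.option_getD.comp (Primrec.decode.comp (Primrec.fst.comp Primrec.unpair))
        (Primrec.const [])) (Primrec.list_cons.comp
      (Primrec.beq.comp (Primrec.snd.comp Primrec.unpair) (Primrec.const 1)) (Primrec.const []))))
  have h1 : RecFun X fun m : ℕ => m.unpair.2.unpair.1 := of_primrec
    (Primrec.fst.comp (Primrec.unpair.comp (Primrec.snd.comp Primrec.unpair)))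
  have h2 : RecFun X fun m : ℕ => m.unpair.2.unpair.2 := of_primrec
    (Primrec.snd.comp (Primrec.unpair.comp (Primrec.snd.comp Primrec.unpair)))
  have h3 := (prec (of_primrec (Primrec.const (encode ([] : List Bool))))
    (hstep.comp (h2.pair (hchi.comp h1)))).comp
    (pair (of_primrec (Primrec.const 0)) (of_primrec Primrec.id))
  convert h3 using 2 with k
  simp only [Nat.unpair_pair, id]
  induction k with
  | zero => rfl
  | succ k ih =>
    simp only [← ih, encodek, Option.getD_some, seg_succ]
    by_cases hk : k ∈ X <;> simp [hk]

end RecFun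

/-- Uniformization: a relation that is r.e. in `X` has a selection function that is partial
computable in `X`. -/
theorem REIn.exists_code {α : Type} [Primcodable α] {X : Set ℕ} {r : α → ℕ → Prop}
    (hr : REIn X fun x : α × ℕ => r x.1 x.2) : ∃ c : OCode, ∀ a,
      ((∃ y, r a y) → (c.eval X (encode a)).Dom) ∧ ∀ y ∈ c.eval X (encode a), r a y := by
  classical
  obtain ⟨R, hR, h⟩ := hr
  -- `k` codes the pair of a value and the length of an oracle segment that witnesses it
  have ht : RecFun X fun m : ℕ => if ∃ a ∈ (decode m.unpair.1 : Option α),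
      R (a, m.unpair.2.unpair.1) (seg X m.unpair.2.unpair.2) then 0 else 1 := by
    have h0 : PrimrecPred fun q : ℕ => ∃ a ∈ (decode q.unpair.1.unpair.1 : Option α),
        ∃ σ ∈ (decode q.unpair.2 : Option (List Bool)),
          R (a, q.unpair.1.unpair.2.unpair.1) σ := by
      have U1 : Primrec fun n : ℕ => n.unpair.1 := Primrec.fst.comp Primrec.unpair
      have U2 : Primrec fun n : ℕ => n.unpair.2 := Primrec.snd.comp Primrec.unpair
      refine primrecPred_exists_mem_option (q := fun (q : ℕ) a =>
        ∃ σ ∈ (decode q.unpair.2 : Option (List Bool)), R (a, q.unpair.1.unpair.2.unpair.1) σ)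
        (Primrec.decode.comp (U1.comp U1)) ?_
      refine primrecPred_exists_mem_option (q := fun (x : ℕ × α) σ =>
        R (x.2, x.1.unpair.1.unpair.2.unpair.1) σ) (Primrec.decode.comp (U2.comp Primrec.fst)) ?_
      exact hR.comp (((Primrec.snd.comp Primrec.fst).pair
        (U1.comp (U2.comp (U1.comp (Primrec.fst.comp Primrec.fst))))).pair Primrec.snd)
    have h1 : RecFun X fun m : ℕ => encode (seg X m.unpair.2.unpair.2) :=
      (RecFun.encode_seg X).comp (RecFun.of_primrec
        (Primrec.snd.comp (Primrec.unpair.comp (Primrec.snd.comp Primrec.unpair))))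
    have h2 := (RecFun.of_primrec (X := X) (Primrec.ite h0 (Primrec.const 0)
      (Primrec.const 1))).comp ((RecFun.of_primrec Primrec.id).pair h1)
    simpa using h2
  have h3 := Nat.RecursiveIn.comp (RecFun.of_primrec (X := X) (Primrec.fst.comp Primrec.unpair))
    (Nat.RecursiveIn.rfind ht)
  obtain ⟨c, hc⟩ := (OCode.recursiveIn_iff_exists_eval X _).1 h3
  refine ⟨c, fun a => ?_⟩
  rw [hc]
  have key : ∀ k, (∃ b ∈ (decode (Nat.pair (encode a) k).unpair.1 : Option α),
      R (b, (Nat.pair (encode a) k).unpair.2.unpair.1)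
        (seg X (Nat.pair (encode a) k).unpair.2.unpair.2)) ↔
      R (a, k.unpair.1) (seg X k.unpair.2) := by simp
  constructor
  · rintro ⟨y, hy⟩
    obtain ⟨n, hn⟩ := (h (a, y)).1 hy
    simp only [key, Part.bind_eq_bind, Part.bind_dom, Part.map_eq_map, Part.map_some]
    refine ⟨Nat.rfind_dom.2 ⟨Nat.pair y n, ?_, fun _ => trivial⟩, trivial⟩
    simpa using hn
  · intro y hy
    obtain ⟨k, hk, hy⟩ := Part.mem_bind_iff.1 hy
    have := (Nat.mem_rfind.1 hk).1
    simp only [key, Part.map_eq_map, Part.map_some] at this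
    obtain rfl := Part.mem_some_iff.1 hy
    refine (h (a, _)).2 ⟨k.unpair.2, ?_⟩
    simpa using this

/-! ### Reducibility, computability and the jump in terms of r.e. relations -/

/-- Post's theorem, relative to `B`. -/
theorem tRed_iff {A B : Set ℕ} : TRed A B ↔ REIn B (· ∈ A) ∧ REIn B (· ∉ A) := by
  classical
  rw [TRed, TuringReducible, RecursiveIn.iff_nat, OCode.recursiveIn_iff_exists_eval]
  constructor
  · rintro ⟨c, hc⟩
    have h := REIn.mem_eval B c
    simp only [hc, chi, Part.mem_some_iff] at h
    refine ⟨(h.comp (Primrec.id.pair (Primrec.const 1))).of_iff fun n => ?_,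
      (h.comp (Primrec.id.pair (Primrec.const 0))).of_iff fun n => ?_⟩
    · by_cases hn : n ∈ A <;> simp [hn]
    · by_cases hn : n ∈ A <;> simp [hn]
  · rintro ⟨h, h'⟩
    obtain ⟨c, hc⟩ := REIn.exists_code
      (r := fun (n : ℕ) y => (n ∈ A ∧ y = 1) ∨ (n ∉ A ∧ y = 0)) (X := B)
      (((h.comp Primrec.fst).and (.of_primrec (primrecPred_eq Primrec.snd (Primrec.const 1)))).or
      ((h'.comp Primrec.fst).and (.of_primrec (primrecPred_eq Primrec.snd (Primrec.const 0)))))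
    refine ⟨c, funext fun n => ?_⟩
    obtain ⟨h1, h2⟩ := hc n
    have h3 := h1 (by by_cases hn : n ∈ A <;> simp [hn])
    obtain ⟨y, hy⟩ := Part.dom_iff_mem.1 h3
    have h4 := h2 y hy
    rw [encode_nat] at hy
    rw [Part.eq_some_iff.2 hy, chi]
    by_cases hn : n ∈ A <;> simp_all

/-- Post's theorem for functions with values in `Bool`, on any `Primcodable` type. -/
theorem computableIn_bool_iff {α : Type} [Primcodable α] {X : Set ℕ} {f : α → Bool} :
    ComputableIn {chi X} f ↔ REIn X (fun a => f a = true) ∧ REIn X (fun a => f a = false) := by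
  refine (OCode.recursiveIn_iff_exists_eval X fun n => Part.bind (decode (α := α) n)
    fun a => (Part.some (f a)).map encode).trans ?_
  constructor
  · rintro ⟨c, hc⟩
    have h := (REIn.mem_eval X c).comp (α := α × Bool)
      ((Primrec.encode.comp Primrec.fst).pair (Primrec.encode.comp Primrec.snd))
    have e : ∀ x : α × Bool, encode x.2 ∈ c.eval X (encode x.1) ↔ f x.1 = x.2 := fun x => by
      rw [hc]
      simp [eq_comm]
    simp only [e] at h
    exact ⟨h.comp (Primrec.id.pair (Primrec.const true)),
      h.comp (Primrec.id.pair (Primrec.const false))⟩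
  · rintro ⟨h, h'⟩
    obtain ⟨c, hc⟩ := REIn.exists_code (X := X) (r := fun (n : ℕ) y => ∃ a : α,
        decode n = some a ∧ ((f a = true ∧ y = 1) ∨ (f a = false ∧ y = 0))) (by
      refine .ex (q := fun (x : ℕ × ℕ) (a : α) => decode x.1 = some a ∧
        ((f a = true ∧ x.2 = 1) ∨ (f a = false ∧ x.2 = 0))) ?_
      have hy : Primrec fun x : (ℕ × ℕ) × α => x.1.2 := Primrec.snd.comp Primrec.fst
      exact .and (.of_primrec (primrecPred_eq (Primrec.decode.comp (Primrec.fst.comp Primrec.fst))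
        (Primrec.option_some.comp Primrec.snd))) (.or ((h.comp Primrec.snd).and
          (.of_primrec (primrecPred_eq hy (Primrec.const 1)))) ((h'.comp Primrec.snd).and
          (.of_primrec (primrecPred_eq hy (Primrec.const 0))))))
    refine ⟨c, funext fun n => ?_⟩
    obtain ⟨h1, h2⟩ := hc n
    rw [encode_nat] at h1 h2
    rcases ha : (decode n : Option α) with _ | a
    · simp only [Part.coe_none, Part.bind_none]
      refine Part.eq_none_iff.2 fun y hy => ?_
      obtain ⟨a, ha', -⟩ := h2 y hy
      simp [ha] at ha'
    · simp only [Part.coe_some, Part.bind_some, Part.map_some]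
      have h3 := h1 (by cases hf : f a <;> simp [ha, hf])
      obtain ⟨y, hy⟩ := Part.dom_iff_mem.1 h3
      obtain ⟨b, hb, h4⟩ := h2 y hy
      rw [Part.eq_some_iff.2 hy]
      obtain rfl : a = b := by rw [ha] at hb; exact Option.some_inj.1 hb
      rcases h4 with ⟨hf, rfl⟩ | ⟨hf, rfl⟩ <;> rw [hf] <;> rfl

theorem TRed.refl (A : Set ℕ) : TRed A A := tRed_iff.2 ⟨.mem_self A, .notMem_self A⟩

theorem REIn.mono {α : Type} [Primcodable α] {A B : Set ℕ} (h : TRed A B) {p : α → Prop}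
    (hp : REIn A p) : REIn B p :=
  REIn.subst (tRed_iff.1 h).1 (tRed_iff.1 h).2 hp

theorem TRed.trans {A B C : Set ℕ} (h : TRed A B) (h' : TRed B C) : TRed A C :=
  TuringReducible.trans h h'

/-- Relations that are r.e. in `X` are many-one reducible to the jump of `X`. -/
theorem REIn.reduces_to_jump {α : Type} [Primcodable α] {X : Set ℕ} {p : α → Prop}
    (hp : REIn X p) : ∃ g : α → ℕ, Primrec g ∧ ∀ a, p a ↔ g a ∈ IterJump.jump X := by
  obtain ⟨c, hc⟩ := REIn.exists_code (r := fun a (_ : ℕ) => p a) (hp.comp Primrec.fst)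
  refine ⟨fun a => (OCode.comp c (OCode.const (encode a))).encode, ?_, fun a => ?_⟩
  · exact Primrec.nat_add.comp (Primrec.nat_mul.comp (Primrec.const 4)
      (Primrec₂.natPair.comp (Primrec.const _)
        (OCode.primrec_encode_const.comp Primrec.encode))) (Primrec.const 6)
  · have e : ∀ n, (OCode.comp c (OCode.const (encode a))).eval X n = c.eval X (encode a) :=
      fun n => by
        simp only [OCode.eval, OCode.eval_const]
        exact Part.bind_some _ _
    constructor
    · intro h
      exact ⟨_, rfl, by rw [e]; exact (hc a).1 ⟨0, h⟩⟩
    · rintro ⟨d, hd, h⟩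
      rw [OCode.encode_injective hd, e] at h
      obtain ⟨y, hy⟩ := Part.dom_iff_mem.1 h
      exact (hc a).2 y hy

theorem REIn.re_jump {α : Type} [Primcodable α] {X : Set ℕ} {p : α → Prop}
    (hp : REIn X p) : REIn (IterJump.jump X) p := by
  obtain ⟨g, hg, h⟩ := hp.reduces_to_jump
  exact ((REIn.mem_self _).comp hg).of_iff h

theorem REIn.not_re_jump {α : Type} [Primcodable α] {X : Set ℕ} {p : α → Prop}
    (hp : REIn X p) : REIn (IterJump.jump X) fun a => ¬ p a := by
  obtain ⟨g, hg, h⟩ := hp.reduces_to_jump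
  exact ((REIn.notMem_self _).comp hg).of_iff fun a => not_congr (h a)

theorem tRed_jump (X : Set ℕ) : TRed X (jump X) :=
  tRed_iff.2 ⟨(REIn.mem_self X).re_jump, (REIn.notMem_self X).re_jump⟩

theorem TRed.jump {A B : Set ℕ} (h : TRed A B) : TRed (jump A) (jump B) :=
  tRed_iff.2 ⟨((REIn.jump A).mono h).re_jump, ((REIn.jump A).mono h).not_re_jump⟩

theorem iterJump_succ (m : ℕ) (X : Set ℕ) : iterJump (m + 1) X = jump (iterJump m X) :=
  Function.iterate_succ_apply' _ _ _

theorem TRed.iterJump {A B : Set ℕ} (h : TRed A B) (m : ℕ) :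
    TRed (iterJump m A) (iterJump m B) := by
  induction m with
  | zero => exact h
  | succ m ih => rw [iterJump_succ, iterJump_succ]; exact ih.jump

/-! ### Paths through binary trees -/

/-- The list of all binary strings of length `n`. -/
def strings : ℕ → List (List Bool)
  | 0 => [[]]
  | n + 1 => (strings n).flatMap fun σ => [true :: σ, false :: σ]

theorem mem_strings {n : ℕ} {σ : List Bool} : σ ∈ strings n ↔ σ.length = n := by
  induction n generalizing σ with
  | zero => simp [strings]
  | succ n ih => rcases σ with _ | ⟨_ | _, σ⟩ <;> simp [strings, ih]

theorem primrec_strings : Primrec strings := by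
  refine (Primrec.nat_rec₁ (f := fun _ l => l.flatMap fun σ => [true :: σ, false :: σ]) [[]]
    (Primrec.to₂ (Primrec.list_flatMap (f := fun x : ℕ × List (List Bool) => x.2)
      (g := fun _ σ => [true :: σ, false :: σ]) Primrec.snd ?_))).of_eq fun n => ?_
  · exact (Primrec.list_cons.comp (Primrec.list_cons.comp (Primrec.const true) Primrec.snd)
      (Primrec.list_cons.comp (Primrec.list_cons.comp (Primrec.const false) Primrec.snd)
        (Primrec.const []))).to₂
  · induction n with
    | zero => rfl
    | succ n ih => simp only [strings, ← ih]

/-- `S` is closed under initial segments. -/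
def PrefixClosed (S : Set (List Bool)) : Prop := ∀ σ ∈ S, ∀ τ : List Bool, τ <+: σ → τ ∈ S

/-- `σ` has extensions of every length in `S`. -/
def Extendible (S : Set (List Bool)) (σ : List Bool) : Prop :=
  ∀ n, ∃ τ ∈ strings n, σ ++ τ ∈ S

theorem Extendible.append_or {S : Set (List Bool)} (hS : PrefixClosed S) {σ : List Bool}
    (h : Extendible S σ) : Extendible S (σ ++ [true]) ∨ Extendible S (σ ++ [false]) := by
  by_contra! hc
  simp only [Extendible, not_forall, not_exists, not_and] at hc
  obtain ⟨⟨n, hn⟩, m, hm⟩ := hc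
  obtain ⟨τ, hτ, hS'⟩ := h (max n m + 1)
  rcases τ with _ | ⟨b, τ⟩
  · simp [mem_strings] at hτ
  · have hl : τ.length = max n m := by simpa [mem_strings] using hτ
    have hpre : ∀ k, k ≤ τ.length → (σ ++ [b]) ++ τ.take k ∈ S := fun k _ => by
      refine hS _ hS' _ ?_
      rw [show σ ++ b :: τ = (σ ++ [b]) ++ τ by simp]
      exact (List.prefix_append_right_inj _).2 (List.take_prefix _ _)
    cases b
    · exact hm (τ.take m) (mem_strings.2 (by simp [hl])) (hpre m (by omega))
    · exact hn (τ.take n) (mem_strings.2 (by simp [hl])) (hpre n (by omega))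

/-- The initial segments of the path that follows the choices of `c`. -/
def pathSeq (c : List Bool → Bool) : ℕ → List Bool
  | 0 => []
  | n + 1 => pathSeq c n ++ [c (pathSeq c n)]

/-- If `c` always picks a bit that preserves extendibility, its choices form a path. -/
theorem isPath_pathSeq {S : Set (List Bool)} {c : List Bool → Bool} (h0 : Extendible S [])
    (hc : ∀ σ, Extendible S σ → Extendible S (σ ++ [c σ])) :
    IsPath (fun n => c (pathSeq c n)) S := by
  have e : ∀ n, (List.range n).map (fun n => c (pathSeq c n)) = pathSeq c n := fun n => by
    induction n with
    | zero => rfl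
    | succ n ih => rw [List.range_succ, List.map_append, ih]; rfl
  have hext : ∀ n, Extendible S (pathSeq c n) := fun n => by
    induction n with
    | zero => exact h0
    | succ n ih => exact hc _ ih
  intro n
  rw [e]
  obtain ⟨τ, hτ, h⟩ := hext n 0
  simpa [List.length_eq_zero_iff.1 (mem_strings.1 hτ)] using h

/-- **König's lemma** for binary trees. -/
theorem exists_set_of_prefixClosed {S : Set (List Bool)} (hS : PrefixClosed S)
    (h : ∀ n, ∃ σ ∈ S, σ.length = n) : ∃ P : Set ℕ, ∀ n, seg P n ∈ S := by
  classical
  have h0 : Extendible S [] := fun n => by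
    obtain ⟨σ, hσ, hl⟩ := h n
    exact ⟨σ, mem_strings.2 hl, hσ⟩
  have hp := isPath_pathSeq (c := fun σ => decide (Extendible S (σ ++ [true]))) h0 fun σ hσ => by
    by_cases ht : Extendible S (σ ++ [true])
    · simp [ht]
    · simpa [ht] using (hσ.append_or hS).resolve_left ht
  set f := fun n => (fun σ => decide (Extendible S (σ ++ [true])))
    (pathSeq (fun σ => decide (Extendible S (σ ++ [true]))) n) with hf
  refine ⟨{n | f n = true}, fun n => ?_⟩
  have : seg {n | f n = true} n = (List.range n).map f := by
    simp only [seg, Set.mem_ofPred_eq]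
    exact List.map_congr_left fun i _ => by simp
  rw [this]
  exact hp n

/-! ### Diagonally noncomputable sets have PA degree -/

/-- `P`, as a `0`-`1`-valued function, is diagonally noncomputable relative to `X`: it differs at
`e` from `Φ_e^X(e)`, for every `e` at which the latter is defined. -/
def IsDNR₂ (P X : Set ℕ) : Prop :=
  ∀ c : OCode, (1 ∈ c.eval X c.encode → c.encode ∉ P) ∧ (0 ∈ c.eval X c.encode → c.encode ∈ P)

theorem REIn.not_extendible {S : Set (List Bool)} {X : Set ℕ} (h : REIn X (· ∉ S)) :
    REIn X fun σ => ¬ Extendible S σ := by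
  refine of_iff (p := fun σ => ∃ n, ∀ τ ∈ strings n, σ ++ τ ∉ S)
    (.ex (q := fun σ n => ∀ τ ∈ strings n, σ ++ τ ∉ S) (.forall_mem
      (q := fun (x : List Bool × ℕ) τ => x.1 ++ τ ∉ S) (primrec_strings.comp Primrec.snd) ?_))
    fun σ => by simp [Extendible]
  exact h.comp (Primrec.list_append.comp (Primrec.fst.comp Primrec.fst) Primrec.snd)

/-- Let `Φ_{c σ}^X` be constant with value some bit `b` for which `σ ++ [b]` is seen to be not
extendible in `T`. A diagonally noncomputable set differs from this value at the number of `c σ`,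
so its values there guide a path through `T`. -/
theorem IsDNR₂.paOver {P X : Set ℕ} (h : IsDNR₂ P X) : PAOver P X := by
  classical
  intro T hT hcomp
  have hTn : REIn X (· ∉ T) := by
    have := (computableIn_bool_iff.1 hcomp).2
    simp only [decide_eq_false_iff_not] at this
    exact this
  have hcl : PrefixClosed T := hT.2
  have hdead := hTn.not_extendible
  have happ (b : Bool) : Primrec fun x : List Bool × ℕ => x.1 ++ [b] :=
    Primrec.list_append.comp Primrec.fst (Primrec.const [b])
  obtain ⟨d, hd⟩ := REIn.exists_code (X := X) (r := fun (σ : List Bool) y =>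
    (¬ Extendible T (σ ++ [true]) ∧ y = 1) ∨ (¬ Extendible T (σ ++ [false]) ∧ y = 0))
    (((hdead.comp (happ true)).and (.of_primrec (primrecPred_eq Primrec.snd (Primrec.const 1)))).or
    ((hdead.comp (happ false)).and (.of_primrec (primrecPred_eq Primrec.snd (Primrec.const 0)))))
  let c : List Bool → OCode := fun σ => OCode.comp d (OCode.const (encode σ))
  have hg : Primrec fun σ => (c σ).encode :=
    Primrec.nat_add.comp (Primrec.nat_mul.comp (Primrec.const 4)
      (Primrec₂.natPair.comp (Primrec.const _)
        (OCode.primrec_encode_const.comp Primrec.encode))) (Primrec.const 6)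
  have hc : ∀ σ n, (c σ).eval X n = d.eval X (encode σ) := fun σ n => by
    simp only [c, OCode.eval, OCode.eval_const]
    exact Part.bind_some _ _
  let choice : List Bool → Bool := fun σ => decide ((c σ).encode ∈ P)
  have h0 : Extendible T [] := by
    intro n
    by_contra! hn
    refine hT.1 ((List.finite_length_lt Bool n).subset fun σ hσ => ?_)
    by_contra hl
    simp only [Set.mem_ofPred_eq, not_lt] at hl
    exact hn (σ.take n) (mem_strings.2 (by simp [hl])) (hT.2 σ hσ _ (List.take_prefix _ _))
  refine ⟨_, isPath_pathSeq (c := choice) h0 fun σ hσ => ?_, ?_⟩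
  · by_contra hb
    have hdom : (d.eval X (encode σ)).Dom := by
      refine (hd σ).1 ?_
      by_cases hP : (c σ).encode ∈ P
      · exact ⟨1, .inl ⟨by simpa [choice, hP] using hb, rfl⟩⟩
      · exact ⟨0, .inr ⟨by simpa [choice, hP] using hb, rfl⟩⟩
    obtain ⟨y, hy⟩ := Part.dom_iff_mem.1 hdom
    have hor := hσ.append_or hcl
    obtain ⟨h1, h2⟩ := h (c σ)
    rw [hc] at h1 h2
    rcases (hd σ).2 y hy with ⟨hdt, rfl⟩ | ⟨hdf, rfl⟩
    · exact hb (by simpa [choice, h1 hy] using hor.resolve_left hdt)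
    · exact hb (by simpa [choice, h2 hy] using hor.resolve_right hdf)
  · have hin : REIn P fun σ => (c σ).encode ∈ P := (REIn.mem_self P).comp hg
    have hout : REIn P fun σ => (c σ).encode ∉ P := (REIn.notMem_self P).comp hg
    have hseq : REIn P fun x : ℕ × List Bool => x.2 = pathSeq choice x.1 := by
      refine REIn.seq (step := fun _ σ τ => ((c σ).encode ∈ P ∧ τ = σ ++ [true]) ∨
        ((c σ).encode ∉ P ∧ τ = σ ++ [false])) ?_ fun i τ => ?_
      · have hσ : Primrec fun x : (ℕ × List Bool) × List Bool => x.1.2 :=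
          Primrec.snd.comp Primrec.fst
        have ha (b : Bool) : REIn P fun x : (ℕ × List Bool) × List Bool => x.2 = x.1.2 ++ [b] :=
          .of_primrec (primrecPred_eq Primrec.snd
            (Primrec.list_append.comp hσ (Primrec.const [b])))
        exact ((hin.comp hσ).and (ha true)).or ((hout.comp hσ).and (ha false))
      · by_cases hP : (c (pathSeq choice i)).encode ∈ P <;> simp [pathSeq, choice, hP]
    refine computableIn_bool_iff.2 ⟨?_, ?_⟩
    · refine .of_iff (.ex (q := fun n σ => σ = pathSeq choice n ∧ (c σ).encode ∈ P)
        (hseq.and (hin.comp Primrec.snd))) fun n => by simp [choice]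
    · refine .of_iff (.ex (q := fun n σ => σ = pathSeq choice n ∧ (c σ).encode ∉ P)
        (hseq.and (hout.comp Primrec.snd))) fun n => by simp [choice]

/-- `X` is the only path through the tree of its initial segments. -/
theorem PAOver.tRed {P X : Set ℕ} (h : PAOver P X) : TRed X P := by
  classical
  have hT : IsInfiniteTree {σ | σ = seg X σ.length} := by
    constructor
    · refine Set.infinite_of_injective_forall_mem (f := seg X) (fun m n h => ?_) fun n => by simp
      simpa using congrArg List.length h
    · intro σ hσ τ hτ
      rw [Set.mem_ofPred_eq] at hσ
      rw [hσ] at hτ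
      exact (prefix_seg_iff.1 hτ).2
  have hcomp : ComputableIn {chi X} fun σ : List Bool =>
      decide (σ ∈ {σ | σ = seg X σ.length}) := by
    refine computableIn_bool_iff.2 ⟨?_, ?_⟩
    · simp only [Set.mem_ofPred_eq, decide_eq_true_eq]
      exact REIn.eq_seg (.mem_self X) (.notMem_self X)
    · simp only [Set.mem_ofPred_eq, decide_eq_false_iff_not]
      refine .of_iff (.ex (q := fun σ (τ : List Bool) => τ = seg X τ.length ∧
        τ.length = σ.length ∧ τ ≠ σ) (.and ((REIn.eq_seg (.mem_self X) (.notMem_self X)).comp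
          Primrec.snd) (.of_primrec ((primrecPred_eq (Primrec.list_length.comp Primrec.snd)
            (Primrec.list_length.comp Primrec.fst)).and
          (primrecPred_eq Primrec.snd Primrec.fst).not)))) fun σ => ?_
      constructor
      · exact fun h => ⟨seg X σ.length, by simp, by simp, fun h' => h h'.symm⟩
      · rintro ⟨τ, h1, h2, h3⟩ h4
        rw [h2, ← h4] at h1
        exact h3 h1
  obtain ⟨f, hf, hc⟩ := h _ hT (by convert hcomp)
  have hfX : ∀ n, n ∈ X ↔ f n = true := fun n => by
    have h1 := hf (n + 1)
    simp only [Set.mem_ofPred_eq, List.length_map, List.length_range, seg_succ, List.range_succ,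
      List.map_append, List.map_cons, List.map_nil, List.length_append, List.length_cons,
      List.length_nil] at h1
    have h2 := (List.append_inj' h1 rfl).2
    simp only [List.cons.injEq, and_true] at h2
    simp [h2]
  obtain ⟨h1, h2⟩ := computableIn_bool_iff.1 hc
  exact tRed_iff.2 ⟨h1.of_iff hfX, h2.of_iff fun n => by simp [hfX]⟩

theorem PAOver.mono {P X Y : Set ℕ} (h : PAOver P Y) (hXY : TRed X Y) : PAOver P X :=
  fun T hT hc => h T hT <| by
    rw [computableIn_bool_iff] at hc ⊢
    exact ⟨hc.1.mono hXY, hc.2.mono hXY⟩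

theorem PAOver.mono_left {P Q X : Set ℕ} (h : PAOver P X) (hPQ : TRed P Q) : PAOver Q X :=
  fun T hT hc => by
    obtain ⟨f, hf, hfc⟩ := h T hT hc
    rw [computableIn_bool_iff] at hfc
    exact ⟨f, hf, computableIn_bool_iff.2 ⟨hfc.1.mono hPQ, hfc.2.mono hPQ⟩⟩

/-! ### The low basis theorem -/

/-- The members of `S` on which no computation `Φ_i(i)` with `L[i]` true is seen to halt. -/
def avoiding (S : Set (List Bool)) (L : List Bool) : Set (List Bool) :=
  {σ | σ ∈ S ∧ ∀ i < L.length, L[i]? = some true → ¬ HaltsOn σ i}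

theorem avoiding_append_false (S : Set (List Bool)) (L : List Bool) :
    avoiding S (L ++ [false]) = avoiding S L := by
  ext σ
  refine and_congr_right fun _ => ⟨fun h i hi hL => h i (by simp; omega) ?_, fun h i hi hL => ?_⟩
  · rwa [List.getElem?_append_left hi]
  · by_cases hi' : i < L.length
    · exact h i hi' (by rwa [List.getElem?_append_left hi'] at hL)
    · obtain rfl : i = L.length := by simp at hi; omega
      simp at hL

theorem REIn.not_extendible_avoiding {S : Set (List Bool)} {X : Set ℕ} (h : REIn X (· ∉ S)) :
    REIn X fun L => ¬ Extendible (avoiding S L) [] := by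
  refine of_iff (p := fun L => ∃ n, ∀ σ ∈ strings n,
    σ ∉ S ∨ ∃ i, (i < L.length ∧ L[i]? = some true) ∧ HaltsOn σ i)
    (.ex (.forall_mem (q := fun (x : List Bool × ℕ) σ => σ ∉ S ∨
      ∃ i, (i < x.1.length ∧ x.1[i]? = some true) ∧ HaltsOn σ i)
      (primrec_strings.comp Primrec.snd) (.or (h.comp Primrec.snd)
      (.ex (q := fun (x : (List Bool × ℕ) × List Bool) i =>
        (i < x.1.1.length ∧ x.1.1[i]? = some true) ∧ HaltsOn x.2 i) (.of_primrec ?_)))))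
    fun L => ?_
  · have hL : Primrec fun x : ((List Bool × ℕ) × List Bool) × ℕ => x.1.1.1 :=
      Primrec.fst.comp (Primrec.fst.comp Primrec.fst)
    exact ((Primrec.nat_lt.comp Primrec.snd (Primrec.list_length.comp hL)).and
      (primrecPred_eq (Primrec.list_getElem?.comp hL Primrec.snd) (Primrec.const _))).and
      (primrecPred_haltsOn.comp ((Primrec.snd.comp Primrec.fst).pair Primrec.snd))
  · simp only [Extendible, avoiding, List.nil_append, Set.mem_ofPred_eq]
    push Not
    refine exists_congr fun n => forall₂_congr fun σ _ => ?_
    rw [← imp_iff_not_or]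
    simp only [and_assoc]

/-- **Low basis theorem**, relative to `X`: a nonempty `Π⁰₁(X)` class, given as the set of paths
through a tree `S` whose complement is r.e. in `X`, has a member `P` with `P' ≤_T X'`. -/
theorem exists_low_path {S : Set (List Bool)} {X : Set ℕ} (hS : PrefixClosed S)
    (hre : REIn X (· ∉ S)) (hne : ∀ n, ∃ σ ∈ S, σ.length = n) :
    ∃ P : Set ℕ, (∀ n, seg P n ∈ S) ∧ TRed (jump P) (jump X) := by
  classical
  -- `F` is the set of computations that are made to diverge, greedily: `i` is put into `F` if
  -- this leaves the tree infinite, a question that `X'` answers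
  let c : List Bool → Bool := fun L => decide (Extendible (avoiding S (L ++ [true])) [])
  let F : Set ℕ := {i | c (pathSeq c i) = true}
  have hF : ∀ n, pathSeq c n = seg F n := fun n => by
    induction n with
    | zero => rfl
    | succ n ih => rw [seg_succ, ← ih, pathSeq]; simp [F]
  have hmem : ∀ i, i ∈ F ↔ Extendible (avoiding S (seg F i ++ [true])) [] := fun i => by
    rw [← hF]; simp [F, c]
  have hall : ∀ n, Extendible (avoiding S (seg F n)) [] := fun n => by
    induction n with
    | zero =>
      intro n
      obtain ⟨σ, hσ, hl⟩ := hne n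
      exact ⟨σ, mem_strings.2 hl, hσ, by simp [seg]⟩
    | succ n ih =>
      by_cases hn : n ∈ F
      · simpa [seg_succ, hn] using (hmem n).1 hn
      · simpa [seg_succ, hn, avoiding_append_false] using ih
  obtain ⟨P, hP⟩ := exists_set_of_prefixClosed
    (S := {σ | σ ∈ S ∧ ∀ i ∈ F, ¬ HaltsOn σ i})
    (fun σ hσ τ hτ => ⟨hS σ hσ.1 τ hτ, fun i hi hH => hσ.2 i hi (hH.mono hτ)⟩) fun n => by
      obtain ⟨σ, hσ, hσ', h⟩ := hall n n
      rw [mem_strings] at hσ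
      rw [List.nil_append] at hσ' h
      refine ⟨σ, ⟨hσ', fun i hi hH => ?_⟩, hσ⟩
      have hin : i < n := hσ ▸ hH.1
      exact h i (by simpa using hin) (seg_getElem?_true.2 ⟨hin, hi⟩) hH
  have hjump : ∀ i, i ∈ jump P ↔ ¬ Extendible (avoiding S (seg F i ++ [true])) [] := fun i => by
    rw [← hmem, mem_jump_iff_haltsOn]
    constructor
    · rintro ⟨N, hN⟩ hi
      exact (hP N).2 i hi hN
    · intro hi
      rw [hmem] at hi
      simp only [Extendible, not_forall, not_exists, not_and, List.nil_append] at hi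
      obtain ⟨n, hn⟩ := hi
      have h := hn (seg P n) (by simp [mem_strings])
      simp only [avoiding, Set.mem_ofPred_eq, (hP n).1, true_and, not_forall, not_not] at h
      obtain ⟨j, hj, hj', hH⟩ := h
      refine ⟨n, ?_⟩
      rcases Nat.lt_succ_iff_lt_or_eq.1 (show j < i + 1 by simpa using hj) with hlt | rfl
      · rw [List.getElem?_append_left (by simpa using hlt)] at hj'
        exact absurd hH ((hP n).2 j (seg_getElem?_true.1 hj').2)
      · exact hH
  have happ : Primrec fun L : List Bool => L ++ [true] :=
    Primrec.list_append.comp Primrec.id (Primrec.const [true])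
  have hpos : REIn (jump X) fun L => Extendible (avoiding S L) [] :=
    hre.not_extendible_avoiding.not_re_jump.of_iff fun L => by simp
  have hneg : REIn (jump X) fun L => ¬ Extendible (avoiding S L) [] :=
    hre.not_extendible_avoiding.re_jump
  have hseq : REIn (jump X) fun x : ℕ × List Bool => x.2 = seg F x.1 := by
    refine REIn.seq (step := fun _ L M => (Extendible (avoiding S (L ++ [true])) [] ∧
      M = L ++ [true]) ∨ (¬ Extendible (avoiding S (L ++ [true])) [] ∧ M = L ++ [false]))
      ?_ fun i L => ?_
    · have hL : Primrec fun x : (ℕ × List Bool) × List Bool => x.1.2 :=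
        Primrec.snd.comp Primrec.fst
      have ha (b : Bool) :
          REIn (jump X) fun x : (ℕ × List Bool) × List Bool => x.2 = x.1.2 ++ [b] :=
        .of_primrec (primrecPred_eq Primrec.snd
          (Primrec.list_append.comp hL (Primrec.const [b])))
      exact ((hpos.comp (happ.comp hL)).and (ha true)).or
        ((hneg.comp (happ.comp hL)).and (ha false))
    · rw [← hmem, seg_succ]
      by_cases hi : i ∈ F <;> simp [hi]
  refine ⟨P, fun n => (hP n).1, tRed_iff.2 ⟨?_, ?_⟩⟩
  · refine .of_iff (.ex (q := fun i L => L = seg F i ∧ ¬ Extendible (avoiding S (L ++ [true])) [])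
      (hseq.and (hneg.comp (happ.comp Primrec.snd)))) fun i => by simp [hjump]
  · refine .of_iff (.ex (q := fun i L => L = seg F i ∧ Extendible (avoiding S (L ++ [true])) [])
      (hseq.and (hpos.comp (happ.comp Primrec.snd)))) fun i => by simp [hjump]

/-- The low basis theorem applies to the sets that are diagonally noncomputable relative to `X`,
which are the paths through a tree whose complement is r.e. in `X`. -/
theorem exists_low_paOver (X : Set ℕ) : ∃ P, PAOver P X ∧ TRed (jump P) (jump X) := by
  classical
  have hlow : ∃ P : Set ℕ,
      (∀ n, seg P n ∈ {σ : List Bool | ∀ e, ∀ b ∈ σ[e]?, ¬ Derivable X (e, e, b.toNat)}) ∧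
        TRed (jump P) (jump X) := by
    refine exists_low_path ?_ ?_ ?_
    · rintro σ hσ τ ⟨ρ, rfl⟩ e b hb
      refine hσ e b ?_
      rw [Option.mem_def] at hb ⊢
      rw [List.getElem?_append_left (List.getElem?_eq_some_iff.1 hb).1, hb]
    · refine .of_iff (.ex (q := fun (σ : List Bool) e => ∃ b : Bool, σ[e]? = some b ∧
        Derivable X (e, e, b.toNat)) (.ex (q := fun (x : List Bool × ℕ) (b : Bool) =>
          x.1[x.2]? = some b ∧ Derivable X (x.2, x.2, b.toNat)) ?_)) fun σ => by
          simp only [Set.mem_ofPred_eq, Option.mem_def, not_forall, not_not, exists_prop]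
      have he : Primrec fun x : (List Bool × ℕ) × Bool => x.1.2 := Primrec.snd.comp Primrec.fst
      exact .and (.of_primrec (primrecPred_eq (Primrec.list_getElem?.comp
        (Primrec.fst.comp Primrec.fst) he) (Primrec.option_some.comp Primrec.snd)))
        ((REIn.derivable X).comp
          (he.pair (he.pair ((Primrec.dom_bool Bool.toNat).comp Primrec.snd))))
    · -- `{e | Φ_e^X(e) = 0}` is diagonally noncomputable
      intro n
      refine ⟨seg {e | Derivable X (e, e, 0)} n, fun e b hb hD => ?_, by simp⟩
      obtain ⟨c, rfl⟩ := OCode.encode_surjective e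
      cases b
      · exact (seg_getElem?_false.1 hb).2 hD
      · have h0 : Derivable X (c.encode, c.encode, 0) := (seg_getElem?_true.1 hb).2
        have := Part.mem_unique (mem_eval_iff_derivable.2 h0) (mem_eval_iff_derivable.2 hD)
        simp at this
  obtain ⟨P, hP, hlow⟩ := hlow
  refine ⟨P, IsDNR₂.paOver fun c => ?_, hlow⟩
  have h := hP (c.encode + 1) c.encode
  simp only [mem_eval_iff_derivable]
  constructor
  · intro h1 hc
    exact h true (seg_getElem?_true.2 ⟨by omega, hc⟩) h1
  · intro h0
    by_contra hc
    exact h false (seg_getElem?_false.2 ⟨by omega, hc⟩) h0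

/-! ### Friedberg jump inversion -/

/-- Uniformization, for relations between elements of arbitrary types. -/
theorem REIn.exists_selection {α β : Type} [Primcodable α] [Primcodable β] {X : Set ℕ}
    {r : α → β → Prop} (hr : REIn X fun x : α × β => r x.1 x.2) : ∃ f : α → Option β,
      (∀ a b, f a = some b → r a b) ∧ (∀ a b, r a b → ∃ b', f a = some b') ∧
      REIn X fun x : α × β => f x.1 = some x.2 := by
  classical
  obtain ⟨c, hc⟩ := REIn.exists_code (X := X)
    (r := fun (a : α) y => ∃ b : β, decode y = some b ∧ r a b)
    (.ex (q := fun (x : α × ℕ) (b : β) => decode x.2 = some b ∧ r x.1 b)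
      (.and (.of_primrec (primrecPred_eq (Primrec.decode.comp (Primrec.snd.comp Primrec.fst))
        (Primrec.option_some.comp Primrec.snd)))
        (hr.comp ((Primrec.fst.comp Primrec.fst).pair Primrec.snd))))
  have key : ∀ (a : α) (b : β), (if h : (c.eval X (encode a)).Dom then
      (decode ((c.eval X (encode a)).get h) : Option β) else none) = some b ↔
      ∃ y, y ∈ c.eval X (encode a) ∧ decode y = some b := fun a b => by
    split_ifs with h
    · refine ⟨fun h' => ⟨_, Part.get_mem h, h'⟩, ?_⟩
      rintro ⟨y, hy, hy'⟩
      rwa [Part.get_eq_of_mem hy h]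
    · simp only [false_iff, not_exists, not_and]
      exact fun y hy => absurd (Part.dom_iff_mem.2 ⟨y, hy⟩) h
  refine ⟨fun a => if h : (c.eval X (encode a)).Dom then
      decode ((c.eval X (encode a)).get h) else none, fun a b h => ?_, fun a b h => ?_, ?_⟩
  · obtain ⟨y, hy, hb⟩ := (key a b).1 h
    obtain ⟨b', hb', hr'⟩ := (hc a).2 y hy
    rw [hb, Option.some_inj] at hb'
    exact hb' ▸ hr'
  · obtain ⟨y, hy⟩ := Part.dom_iff_mem.1 ((hc a).1 ⟨encode b, b, encodek b, h⟩)
    obtain ⟨b', hb', -⟩ := (hc a).2 y hy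
    exact ⟨b', (key a b').2 ⟨y, hy, hb'⟩⟩
  · refine .of_iff (.ex (q := fun (x : α × β) y => y ∈ c.eval X (encode x.1) ∧
      decode y = some x.2) (.and ((REIn.mem_eval X c).comp
        ((Primrec.encode.comp (Primrec.fst.comp Primrec.fst)).pair Primrec.snd))
        (.of_primrec (primrecPred_eq (Primrec.decode.comp Primrec.snd)
          (Primrec.option_some.comp (Primrec.snd.comp Primrec.fst)))))) fun x => key x.1 x.2

/-- Strings of even length whose bits at odd positions list an initial segment of `X`: the bit at
position `2 * k + 1` says whether `k` is in `X`. -/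
def CodesOdd (X : Set ℕ) (τ : List Bool) : Prop :=
  τ.length % 2 = 0 ∧ ∀ i < τ.length, i % 2 = 0 ∨
    ((τ[i]? = some true ∧ i / 2 ∈ X) ∨ (τ[i]? = some false ∧ i / 2 ∉ X))

theorem REIn.codesOdd (X : Set ℕ) : REIn X (CodesOdd X) := by
  have hmod (f : List Bool × ℕ → ℕ) (hf : Primrec f) :
      PrimrecPred fun x : List Bool × ℕ => f x % 2 = 0 :=
    primrecPred_eq (Primrec.nat_mod.comp hf (Primrec.const 2)) (Primrec.const 0)
  have hdiv : Primrec fun x : List Bool × ℕ => x.2 / 2 :=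
    Primrec.nat_div.comp Primrec.snd (Primrec.const 2)
  have hget (b : Bool) : PrimrecPred fun x : List Bool × ℕ => x.1[x.2]? = some b :=
    primrecPred_eq (Primrec.list_getElem?.comp Primrec.fst Primrec.snd) (Primrec.const _)
  refine .and (.of_primrec (primrecPred_eq (Primrec.nat_mod.comp Primrec.list_length
    (Primrec.const 2)) (Primrec.const 0))) (.forall_lt (q := fun (τ : List Bool) i => i % 2 = 0 ∨
    ((τ[i]? = some true ∧ i / 2 ∈ X) ∨ (τ[i]? = some false ∧ i / 2 ∉ X))) Primrec.list_length ?_)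
  exact .or (.of_primrec (hmod _ Primrec.snd)) (.or
    (.and (.of_primrec (hget true)) ((REIn.mem_self X).comp hdiv))
    (.and (.of_primrec (hget false)) ((REIn.notMem_self X).comp hdiv)))

theorem CodesOdd.append {X : Set ℕ} {τ : List Bool} (h : CodesOdd X τ) (a x : Bool)
    (hx : x = true ↔ τ.length / 2 ∈ X) : CodesOdd X (τ ++ [a, x]) := by
  obtain ⟨h0, h1⟩ := h
  refine ⟨by simp; omega, fun i hi => ?_⟩
  simp only [List.length_append, List.length_cons, List.length_nil] at hi
  rcases lt_trichotomy i τ.length with hlt | rfl | hgt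
  · rw [List.getElem?_append_left hlt]
    exact h1 i hlt
  · exact .inl h0
  · obtain rfl : i = τ.length + 1 := by omega
    refine .inr ?_
    rw [show (τ.length + 1) / 2 = τ.length / 2 by omega, ← hx]
    cases x <;> simp

/-- The set whose characteristic function is the union of a chain of strings. -/
theorem exists_set_of_chain {s : ℕ → List Bool} (hs : ∀ n, s n <+: s (n + 1)) :
    ∃ Q : Set ℕ, ∀ n, s n = seg Q (s n).length := by
  have hmono : ∀ m n, m ≤ n → s m <+: s n := fun m n h => by
    induction h with
    | refl => exact List.prefix_refl _
    | step _ ih => exact ih.trans (hs _)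
  refine ⟨{i | ∃ n, (s n)[i]? = some true}, fun n => eq_seg_iff.2 fun i hi => ?_⟩
  have hval : (s n)[i]? = some (s n)[i] := List.getElem?_eq_getElem hi
  rcases hb : (s n)[i] with _ | _
  · rw [hb] at hval
    refine .inr ⟨hval, ?_⟩
    rintro ⟨m, hm⟩
    have hi' := (List.getElem?_eq_some_iff.1 hm).1
    rcases le_total m n with h | h
    · obtain ⟨ρ, hρ⟩ := hmono m n h
      rw [← hρ, List.getElem?_append_left hi', hm] at hval
      simp at hval
    · obtain ⟨ρ, hρ⟩ := hmono n m h
      rw [← hρ, List.getElem?_append_left hi, hval] at hm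
      simp at hm
  · rw [hb] at hval
    exact .inl ⟨hval, n, hval⟩

/-- **Friedberg jump inversion**, relative to `X`: every `A ≥_T X'` is Turing equivalent to the jump
of some `Q ≥_T X`. The characteristic function of `Q` is built by finite extension. Stage `n` first
decides, with the help of `X'`, whether `n ∈ Q'`, and then codes the bits `A(n)` and `X(k)`, with
the `k` required by `CodesOdd`. -/
theorem exists_jump_inversion {X A : Set ℕ} (hA : TRed (jump X) A) :
    ∃ Q, TRed X Q ∧ TRed (jump Q) A ∧ TRed A (jump Q) := by
  classical
  let r : ℕ × List Bool → List Bool → Prop := fun x τ =>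
    x.2 <+: τ ∧ CodesOdd X τ ∧ HaltsOn τ x.1
  have hr : REIn X fun x : (ℕ × List Bool) × List Bool => r x.1 x.2 :=
    .and (.of_primrec (primrecPred_prefix.comp ((Primrec.snd.comp Primrec.fst).pair Primrec.snd)))
      (.and ((REIn.codesOdd X).comp Primrec.snd) (.of_primrec
        (primrecPred_haltsOn.comp (Primrec.snd.pair (Primrec.fst.comp Primrec.fst)))))
  obtain ⟨f, hf, hf', hfre⟩ := hr.exists_selection
  -- `ext (e, σ)` extends `σ` so as to make `Φ_e(e)` halt, if that is possible
  let ext : ℕ × List Bool → List Bool := fun x => (f x).getD x.2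
  have hext : REIn (jump X) fun x : (ℕ × List Bool) × List Bool => x.2 = ext x.1 := by
    have h1 : REIn X fun x : ℕ × List Bool => ∃ τ, f x = some τ := .ex hfre
    refine .of_iff (hfre.re_jump.or ((h1.not_re_jump.comp Primrec.fst).and
      (.of_primrec (primrecPred_eq Primrec.snd (Primrec.snd.comp Primrec.fst))))) fun x => ?_
    rcases hx : f x.1 with _ | τ
    · simp [ext, hx]
    · simp [ext, hx, eq_comm]
  let next : ℕ → List Bool → List Bool := fun n σ =>
    ext (n, σ) ++ [decide (n ∈ A), decide ((ext (n, σ)).length / 2 ∈ X)]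
  obtain ⟨s, hs0, hs⟩ : ∃ s : ℕ → List Bool, s 0 = [] ∧ ∀ n, s (n + 1) = next n (s n) :=
    ⟨fun n => Nat.rec [] next n, rfl, fun _ => rfl⟩
  have hpre : ∀ n σ, σ <+: ext (n, σ) := fun n σ => by
    rcases hx : f (n, σ) with _ | τ
    · simp [ext, hx]
    · simpa [ext, hx] using (hf _ _ hx).1
  have hcodes : ∀ n, CodesOdd X (s n) ∧ CodesOdd X (ext (n, s n)) := fun n => by
    have hone : ∀ σ, CodesOdd X σ → CodesOdd X (ext (n, σ)) := fun σ hσ => by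
      rcases hx : f (n, σ) with _ | τ
      · simpa [ext, hx] using hσ
      · simpa [ext, hx] using (hf _ _ hx).2.1
    have : CodesOdd X (s n) := by
      clear hone
      induction n with
      | zero => exact hs0 ▸ ⟨rfl, by simp⟩
      | succ n ih =>
        rw [hs]
        refine CodesOdd.append ?_ _ _ (by simp)
        rcases hx : f (n, s n) with _ | τ
        · simpa [ext, hx] using ih
        · simpa [ext, hx] using (hf _ _ hx).2.1
    exact ⟨this, hone _ this⟩
  have hstep : ∀ n, s n <+: s (n + 1) := fun n => by
    rw [hs]
    exact (hpre n (s n)).trans (List.prefix_append _ _)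
  have hlen : ∀ n, n ≤ (s n).length := fun n => by
    induction n with
    | zero => simp
    | succ n ih =>
      have := (hpre n (s n)).length_le
      rw [hs]
      simp only [next, List.length_append, List.length_cons, List.length_nil]
      omega
  obtain ⟨Q, hQ⟩ := exists_set_of_chain hstep
  have hXQ : TRed X Q := by
    have hbit : ∀ n, n ∈ X ↔ 2 * n + 1 ∈ Q := fun n => by
      have hl := hlen (2 * n + 2)
      have h1 := (hcodes (2 * n + 2)).1.2 (2 * n + 1) (by omega)
      rw [hQ (2 * n + 2), seg_getElem?_true, seg_getElem?_false,
        show (2 * n + 1) / 2 = n by omega] at h1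
      rcases h1 with h1 | ⟨⟨-, h1⟩, h2⟩ | ⟨⟨-, h1⟩, h2⟩
      · omega
      · exact iff_of_true h2 h1
      · exact iff_of_false h2 h1
    exact tRed_iff.2 ⟨((REIn.mem_self Q).comp Primrec.nat_double_succ).of_iff hbit,
      ((REIn.notMem_self Q).comp Primrec.nat_double_succ).of_iff fun n => not_congr (hbit n)⟩
  -- the construction decides at stage `e` whether `e` is in the jump of `Q`
  have hjump : ∀ e, e ∈ jump Q ↔ ∃ τ, r (e, s e) τ := fun e => by
    rw [mem_jump_iff_haltsOn]
    constructor
    · rintro ⟨N, hN⟩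
      have hmono : s e <+: s (max e N) := by
        rw [hQ e, hQ (max e N)]
        refine seg_prefix_seg Q ?_
        exact monotone_nat_of_le_succ (f := fun n => (s n).length)
          (fun n => (hstep n).length_le) (le_max_left e N)
      refine ⟨s (max e N), hmono, (hcodes _).1, hN.mono ?_⟩
      rw [hQ (max e N)]
      exact seg_prefix_seg Q ((le_max_right e N).trans (hlen _))
    · rintro ⟨τ, hτ⟩
      obtain ⟨τ', hτ'⟩ := hf' _ _ hτ
      refine ⟨(s (e + 1)).length, ?_⟩
      rw [← hQ (e + 1), hs]
      have he : ext (e, s e) = τ' := by simp [ext, hτ']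
      refine HaltsOn.mono (σ := τ') ?_ (hf _ _ hτ').2.2
      simp only [next, he]
      exact List.prefix_append _ _
  have hAbit : ∀ n, n ∈ A ↔ (ext (n, s n)).length ∈ Q := fun n => by
    have h1 : (s (n + 1))[(ext (n, s n)).length]? = some (decide (n ∈ A)) := by
      rw [hs]
      simp [next]
    rw [hQ (n + 1)] at h1
    by_cases hn : n ∈ A
    · rw [decide_eq_true hn] at h1
      exact iff_of_true hn (seg_getElem?_true.1 h1).2
    · rw [decide_eq_false hn] at h1
      exact iff_of_false hn (seg_getElem?_false.1 h1).2
  refine ⟨Q, hXQ, ?_, ?_⟩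
  · have hXA : TRed X A := (tRed_jump X).trans hA
    have hseq : REIn A fun x : ℕ × List Bool => x.2 = s x.1 := by
      refine REIn.seq (step := fun n σ ρ => ∃ y : List Bool × Bool × Bool,
        (y.1 = ext (n, σ) ∧ ρ = y.1 ++ [y.2.1, y.2.2]) ∧
        ((y.2.1 = true ∧ n ∈ A) ∨ (y.2.1 = false ∧ n ∉ A)) ∧
        ((y.2.2 = true ∧ y.1.length / 2 ∈ X) ∨ (y.2.2 = false ∧ y.1.length / 2 ∉ X)))
        (.ex (q := fun (x : (ℕ × List Bool) × List Bool) (y : List Bool × Bool × Bool) =>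
        (y.1 = ext x.1 ∧ x.2 = y.1 ++ [y.2.1, y.2.2]) ∧
        ((y.2.1 = true ∧ x.1.1 ∈ A) ∨ (y.2.1 = false ∧ x.1.1 ∉ A)) ∧
        ((y.2.2 = true ∧ y.1.length / 2 ∈ X) ∨ (y.2.2 = false ∧ y.1.length / 2 ∉ X))) ?_)
        fun i ρ => ?_
      · have Y1 : Primrec fun x : ((ℕ × List Bool) × List Bool) × (List Bool × Bool × Bool) =>
          x.2.1 := Primrec.fst.comp Primrec.snd
        have Y2 : Primrec fun x : ((ℕ × List Bool) × List Bool) × (List Bool × Bool × Bool) =>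
          x.2.2.1 := Primrec.fst.comp (Primrec.snd.comp Primrec.snd)
        have Y3 : Primrec fun x : ((ℕ × List Bool) × List Bool) × (List Bool × Bool × Bool) =>
          x.2.2.2 := Primrec.snd.comp (Primrec.snd.comp Primrec.snd)
        have N : Primrec fun x : ((ℕ × List Bool) × List Bool) × (List Bool × Bool × Bool) =>
          x.1.1.1 := Primrec.fst.comp (Primrec.fst.comp Primrec.fst)
        have H : Primrec fun x : ((ℕ × List Bool) × List Bool) × (List Bool × Bool × Bool) =>
          x.2.1.length / 2 := Primrec.nat_div.comp (Primrec.list_length.comp Y1) (Primrec.const 2)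
        refine .and (.and ((hext.mono hA).comp ((Primrec.fst.comp Primrec.fst).pair Y1))
          (.of_primrec (primrecPred_eq (Primrec.snd.comp Primrec.fst) (Primrec.list_append.comp Y1
            (Primrec.list_cons.comp Y2 (Primrec.list_cons.comp Y3 (Primrec.const []))))))) ?_
        exact .and (.or
          (.and (.of_primrec (primrecPred_eq Y2 (Primrec.const _))) ((REIn.mem_self A).comp N))
          (.and (.of_primrec (primrecPred_eq Y2 (Primrec.const _))) ((REIn.notMem_self A).comp N)))
          (.or (.and (.of_primrec (primrecPred_eq Y3 (Primrec.const _)))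
            (((REIn.mem_self X).mono hXA).comp H))
          (.and (.of_primrec (primrecPred_eq Y3 (Primrec.const _)))
            (((REIn.notMem_self X).mono hXA).comp H)))
      · rw [hs]
        constructor
        · rintro ⟨⟨τ, a, x⟩, ⟨h1, h2⟩, h3, h4⟩
          simp only at h1 h2 h3 h4
          subst h1
          rw [h2]
          congr 2
          · rcases h3 with ⟨rfl, h3⟩ | ⟨rfl, h3⟩ <;> simp [h3]
          · rcases h4 with ⟨rfl, h4⟩ | ⟨rfl, h4⟩ <;> simp [h4]
        · rintro rfl
          refine ⟨(ext (i, s i), decide (i ∈ A), decide ((ext (i, s i)).length / 2 ∈ X)),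
            ⟨rfl, rfl⟩, ?_, ?_⟩
          · by_cases h : i ∈ A <;> simp [h]
          · by_cases h : (ext (i, s i)).length / 2 ∈ X <;> simp [h]
    have hex : REIn X fun x : ℕ × List Bool => ∃ τ, r x τ := .ex hr
    refine tRed_iff.2 ⟨.of_iff (.ex (q := fun e σ => σ = s e ∧ ∃ τ, r (e, σ) τ)
      (hseq.and (hex.re_jump.mono hA))) fun e => ?_,
      .of_iff (.ex (q := fun e σ => σ = s e ∧ ¬ ∃ τ, r (e, σ) τ)
      (hseq.and (hex.not_re_jump.mono hA))) fun e => ?_⟩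
    · rw [hjump, exists_eq_left]
    · rw [hjump, exists_eq_left]
  · -- `Q'` can retrace the construction, reading the coded bits of `A` off `Q`
    have hQseg : REIn (jump Q) fun σ : List Bool => σ = seg Q σ.length :=
      (REIn.eq_seg (.mem_self Q) (.notMem_self Q)).re_jump
    have hext' := hext.mono hXQ.jump
    have hseq : REIn (jump Q) fun x : ℕ × List Bool => x.2 = s x.1 := by
      refine REIn.seq (step := fun n σ ρ => ∃ τ, τ = ext (n, σ) ∧
        (ρ = seg Q ρ.length ∧ ρ.length = τ.length + 2))
        (.ex (q := fun (x : (ℕ × List Bool) × List Bool) τ => τ = ext x.1 ∧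
        (x.2 = seg Q x.2.length ∧ x.2.length = τ.length + 2)) (.and
        (hext'.comp ((Primrec.fst.comp Primrec.fst).pair Primrec.snd))
        (.and (hQseg.comp (Primrec.snd.comp Primrec.fst)) (.of_primrec (primrecPred_eq
          (Primrec.list_length.comp (Primrec.snd.comp Primrec.fst))
          (Primrec.nat_add.comp (Primrec.list_length.comp Primrec.snd) (Primrec.const 2)))))))
        fun i ρ => ?_
      have hl : (s (i + 1)).length = (ext (i, s i)).length + 2 := by
        rw [hs]
        simp [next]
      rw [exists_eq_left, ← hl]
      constructor
      · rintro ⟨h1, h2⟩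
        rw [h1, h2, ← hQ (i + 1)]
      · rintro rfl
        exact ⟨hQ _, rfl⟩
    have hboth : REIn (jump Q) fun x : ℕ × List Bool =>
        ∃ σ, σ = s x.1 ∧ x.2 = ext (x.1, σ) := by
      refine .ex (q := fun (x : ℕ × List Bool) σ => σ = s x.1 ∧ x.2 = ext (x.1, σ)) ?_
      have hn : Primrec fun x : (ℕ × List Bool) × List Bool => x.1.1 :=
        Primrec.fst.comp Primrec.fst
      exact .and (hseq.comp (hn.pair Primrec.snd))
        (hext'.comp ((hn.pair Primrec.snd).pair (Primrec.snd.comp Primrec.fst)))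
    have hl : Primrec fun x : ℕ × List Bool => x.2.length := Primrec.list_length.comp Primrec.snd
    refine tRed_iff.2 ⟨.of_iff (.ex (q := fun n τ => (∃ σ, σ = s n ∧ τ = ext (n, σ)) ∧
      τ.length ∈ Q) (hboth.and ((REIn.mem_self Q).re_jump.comp hl))) fun n => ?_,
      .of_iff (.ex (q := fun n τ => (∃ σ, σ = s n ∧ τ = ext (n, σ)) ∧
      τ.length ∉ Q) (hboth.and ((REIn.notMem_self Q).re_jump.comp hl))) fun n => ?_⟩
    · simp only [exists_eq_left, hAbit]
    · simp only [exists_eq_left, hAbit]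

/-- Inversion of the `m`-th jump, relative to `X`. -/
theorem exists_iterJump_inversion (m : ℕ) {X A : Set ℕ} (hA : TRed (iterJump m X) A) :
    ∃ Y, TRed X Y ∧ TRed (iterJump m Y) A ∧ TRed A (iterJump m Y) := by
  induction m generalizing A with
  | zero => exact ⟨A, hA, .refl A, .refl A⟩
  | succ m ih =>
    rw [iterJump_succ] at hA
    obtain ⟨Q, hXQ, h1, h2⟩ := exists_jump_inversion hA
    obtain ⟨Y, hXY, h3, h4⟩ := ih hXQ
    refine ⟨Y, hXY, ?_, ?_⟩
    · rw [iterJump_succ]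
      exact h3.jump.trans h1
    · rw [iterJump_succ]
      exact h2.trans h4.jump

/-- Every `X` is computable in some `Y` with `Y^(m) ≫ X^(m)` and `Y^(m+1) ≤_T X^(m+1)`. -/
theorem exists_iterJump_paOver_low (m : ℕ) (X : Set ℕ) : ∃ Y, TRed X Y ∧
    PAOver (iterJump m Y) (iterJump m X) ∧ TRed (iterJump (m + 1) Y) (iterJump (m + 1) X) := by
  obtain ⟨P, hP, hlow⟩ := exists_low_paOver (iterJump m X)
  obtain ⟨Y, hXY, h1, h2⟩ := exists_iterJump_inversion m hP.tRed
  refine ⟨Y, hXY, hP.mono_left h2, ?_⟩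
  rw [iterJump_succ, iterJump_succ]
  exact h1.jump.trans hlow

/-! ### Turing ideals are `ω`-models -/

theorem Tm.primrec_val {α : Type} [Primcodable α] {w : α → ℕ → ℕ}
    (hw : ∀ i, Primrec fun a => w a i) (t : Tm) : Primrec fun a => t.val (w a) := by
  induction t with
  | var i => exact hw i
  | zero => exact Primrec.const 0
  | one => exact Primrec.const 1
  | add s t hs ht => exact Primrec.nat_add.comp hs ht
  | mul s t hs ht => exact Primrec.nat_mul.comp hs ht

theorem primrec_consVar {α : Type} [Primcodable α] {w : α → ℕ → ℕ} {x : α → ℕ}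
    (hx : Primrec x) (hw : ∀ i, Primrec fun a => w a i) (i : ℕ) :
    Primrec fun a => consVar (x a) (w a) i := by
  cases i with
  | zero => exact hx
  | succ i => exact hw i

/-- A bound for the set variables of a formula. -/
def BFormula.setBound : BFormula → ℕ
  | eq _ _ => 0
  | lt _ _ => 0
  | mem _ i => i + 1
  | not φ => φ.setBound
  | and φ ψ => max φ.setBound ψ.setBound
  | ball _ φ => φ.setBound

/-- Satisfaction of a bounded-quantifier formula is decidable in any set that computes the sets
the formula mentions. -/
theorem BFormula.re_sat {Z : Set ℕ} {V : ℕ → Set ℕ} (φ : BFormula)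
    (hV : ∀ i < φ.setBound, TRed (V i) Z) {α : Type} [Primcodable α] {w : α → ℕ → ℕ}
    (hw : ∀ i, Primrec fun a => w a i) :
    REIn Z (fun a => φ.Sat V (w a)) ∧ REIn Z fun a => ¬ φ.Sat V (w a) := by
  induction φ generalizing α with
  | eq s t =>
    have h := primrecPred_eq (s.primrec_val hw) (t.primrec_val hw)
    exact ⟨.of_primrec h, .of_primrec h.not⟩
  | lt s t =>
    have h := Primrec.nat_lt.comp (s.primrec_val hw) (t.primrec_val hw)
    exact ⟨.of_primrec h, .of_primrec h.not⟩
  | mem t i =>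
    obtain ⟨h1, h2⟩ := tRed_iff.1 (hV i (Nat.lt_succ_self i))
    exact ⟨h1.comp (t.primrec_val hw), h2.comp (t.primrec_val hw)⟩
  | not φ ih =>
    obtain ⟨h1, h2⟩ := ih hV hw
    exact ⟨h2, h1.of_iff fun a => not_not⟩
  | and φ ψ ihφ ihψ =>
    obtain ⟨h1, h2⟩ := ihφ (fun i hi => hV i (lt_max_of_lt_left hi)) hw
    obtain ⟨h3, h4⟩ := ihψ (fun i hi => hV i (lt_max_of_lt_right hi)) hw
    exact ⟨h1.and h3, (h2.or h4).of_iff fun a => not_and_or⟩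
  | ball t φ ih =>
    obtain ⟨h1, h2⟩ := ih (α := α × ℕ) (w := fun x => consVar x.2 (w x.1)) hV
      (primrec_consVar Primrec.snd fun i => (hw i).comp Primrec.fst)
    have ht := t.primrec_val hw
    refine ⟨.forall_lt (q := fun a x => φ.Sat V (consVar x (w a))) ht h1,
      .of_iff (.ex (q := fun a x => x < t.val (w a) ∧ ¬ φ.Sat V (consVar x (w a)))
        (.and (.of_primrec (Primrec.nat_lt.comp Primrec.snd (ht.comp Primrec.fst))) h2))
        fun a => ?_⟩
    simp [BFormula.Sat]

/-- The ideal generated by an increasing sequence of Turing degrees is an `ω`-model. -/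
theorem isOmegaModel_of_chain {Z : ℕ → Set ℕ} (hZ : ∀ k, TRed (Z k) (Z (k + 1))) :
    IsOmegaModel {Y | ∃ k, TRed Y (Z k)} where
  nonempty := ⟨Z 0, 0, .refl _⟩
  sigma1_induction _ _ _ _ h0 hstep k := Nat.rec h0 hstep k
  delta1_comprehension θ η V v hV h := by
    have hmono : ∀ j k, j ≤ k → TRed (Z j) (Z k) := fun j k hjk => by
      induction hjk with
      | refl => exact .refl _
      | step _ ih => exact ih.trans (hZ _)
    choose K hK using hV
    -- a single member of the chain computes all parameters that occur in the two formulas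
    obtain ⟨N, hN⟩ : ∃ N, ∀ i < max θ.setBound η.setBound, TRed (V i) (Z N) :=
      ⟨(Finset.range (max θ.setBound η.setBound)).sup K, fun i hi =>
        (hK i).trans (hmono _ _ (Finset.le_sup (Finset.mem_range.2 hi)))⟩
    have hw : ∀ i, Primrec fun x : ℕ × ℕ => consVar x.2 (consVar x.1 v) i :=
      primrec_consVar Primrec.snd (primrec_consVar Primrec.fst fun i => Primrec.const (v i))
    have h1 := (θ.re_sat (fun i hi => hN i (lt_max_of_lt_left hi)) hw).1
    have h2 := (η.re_sat (fun i hi => hN i (lt_max_of_lt_right hi)) hw).2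
    refine ⟨{k | SatSigma1 θ V (consVar k v)}, ⟨N, tRed_iff.2 ⟨?_, ?_⟩⟩, fun k => Iff.rfl⟩
    · exact .ex (q := fun k x => θ.Sat V (consVar x (consVar k v))) h1
    · refine .of_iff (.ex (q := fun k x => ¬ η.Sat V (consVar x (consVar k v))) h2) fun k => ?_
      rw [Set.mem_ofPred_eq, h, SatPi1, not_forall]

end IterJump

theorem mainTheorem7 (m n : ℕ) (hmn : m < n) :
    ∃ I : Set (Set ℕ), IterJump.IsOmegaModel I ∧
      IterJump.ModelsWKL m I ∧ ¬ IterJump.ModelsAST n I := by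
  open IterJump in
  choose next hle hpa hlow using exists_iterJump_paOver_low m
  let Z : ℕ → Set ℕ := fun k => next^[k] ∅
  have hZ : ∀ k, Z (k + 1) = next (Z k) := fun k => Function.iterate_succ_apply' _ _ _
  refine ⟨{Y | ∃ k, TRed Y (Z k)}, isOmegaModel_of_chain fun k => hZ k ▸ hle _, ?_, ?_⟩
  · rintro X ⟨k, hk⟩
    exact ⟨Z (k + 1), ⟨k + 1, .refl _⟩, hZ k ▸ (hpa (Z k)).mono (hk.iterJump m)⟩
  · intro hAST
    obtain ⟨Y, ⟨k, hk⟩, hY⟩ := hAST (Z 0) ⟨0, .refl _⟩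
    refine hY ((hk.iterJump n).trans ?_)
    clear hk
    induction k with
    | zero => exact .refl _
    | succ k ih =>
      refine TRed.trans ?_ ih
      -- lowness at level `m + 1` persists at the higher level `n`
      obtain ⟨d, rfl⟩ := Nat.exists_eq_add_of_le' (Nat.succ_le_of_lt hmn)
      have hadd : ∀ X, iterJump (d + (m + 1)) X = iterJump d (iterJump (m + 1) X) :=
        fun X => Function.iterate_add_apply _ _ _ _
      rw [hadd, hadd, hZ]
      exact (hlow (Z k)).iterJump d
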